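/- Let $R$ be a commutative artinian ring, let $A$ be an artin $R$-algebra (an $R$-algebra that is finitely generated as an $R$-module), and let $d\geq 0$ be an integer. Write $A\text{-Mod}$ for the category of all (not necessarily finitely generated) left $A$-modules, and put $DA=\mathrm{Hom}_R(A,E)$, where $E$ is the minimal injective cogenerator of $R$, regarded as a left $A$-module by $(af)(x)=f(xa)$. The algebra $A$ is called $d$-Gorenstein if the regular module $A$ has injective dimension at most $d$ both as a left and as a right $A$-module. An acyclic complex $P^\bullet=(P^n)_{n\in\mathbb Z}$ of projective $A$-modules is totally acyclic if $\mathrm{Hom}_A(P^\bullet,Q)$ is acyclic for every projective $A$-module $Q$; an acyclic complex $I^\bullet=(I^n)_{n\in\mathbb Z}$ of injective $A$-modules is cototally acyclic if $\mathrm{Hom}_A(J,I^\bullet)$ is acyclic for every injective $A$-module $J$. Let $A\text{-GProj}$ be the class of modules isomorphic to the zeroth cocycle $Z^0(P^\bullet)$ of a totally acyclic complex, and $A\text{-GInj}$ the class of modules isomorphic to the zeroth coboundary $B^0(I^\bullet)$ of a cototally acyclic complex. Let $\Omega^d(A\text{-Mod})$ be the class of modules $K$ for which there is an exact sequence $0\to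 K\to P_{d-1}\to\cdots\to P_0\to M\to 0$ with all $P_i$ projective, and $\Omega^{-d}(A\text{-Mod})$ the class of modules $K$ for which there is an exact sequence $0\to M\to I^0\to\cdots\to I^{d-1}\to K\to 0$ with all $I^i$ injective (for $d=0$ both are $A\text{-Mod}$). Let $\mathcal P^{\leq d}$ and $\mathcal I^{\leq d}$ be the classes of $A$-modules of projective, respectively injective, dimension at most $d$. Then the following statements are equivalent: (1) the algebra $A$ is $d$-Gorenstein; (2) $A\text{-GProj}=\Omega^d(A\text{-Mod})$; (2') $A\text{-GInj}=\Omega^{-d}(A\text{-Mod})$. In this case, $$A\text{-GProj}=\{M\in A\text{-Mod} : \mathrm{Ext}^i_A(M,A)=0 \text{ for all } i\geq 1\},\qquad A\text{-GInj}=\{M\in A\text{-Mod} : \mathrm{Ext}^i_A(DA,M)=0\text{ for all } i\geq 1\},$$ and $(A\text{-GProj},\mathcal P^{\leq d})$ and $(\mathcal I^{\leq d},A\text{-GInj})$ are cotorsion pairs in $A\text{-Mod}$. Here a cotorsion pair is a pair $(\mathcal F,\mathcal C)$ of full additive subcategories, both closed under direct summands, such that $\mathrm{Ext}^1(F,C)=0$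 for all $F\in\mathcal F$, $C\in\mathcal C$, and such that every object $M$ fits into short exact sequences $0\to C\to F\to M\to 0$ and $0\to M\to C'\to F'\to 0$ with $F,F'\in\mathcal F$ and $C,C'\in\mathcal C$. -/

import Mathlib

open CategoryTheory

universe u v w

noncomputable section

namespace GorensteinArtin

/-! ### The minimal injective cogenerator of a commutative ring -/

section Hull

variable {R : Type u} [Ring R]

/-- `ι : M → E` is an injective envelope of `M`: `E` is injective, `ι` is a monomorphism, and every
submodule of `E` that meets the image of `ι` trivially is zero. -/
structure IsInjectiveHull {M E : Type u} [AddCommGroup M] [Module R M] [AddCommGroup E]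
    [Module R E] (ι : M →ₗ[R] E) : Prop where
  isInjective : Module.Injective R E
  mono : Function.Injective ι
  essential : ∀ N : Submodule R E, N ⊓ LinearMap.range ι = ⊥ → N = ⊥

theorem exists_injectiveHull (M : Type u) [AddCommGroup M] [Module R M] :
    ∃ (E : ModuleCat.{u} R) (ι : M →ₗ[R] E), IsInjectiveHull ι := by
  let J : ModuleCat.{u} R := Injective.under (ModuleCat.of R M)
  let j : M →ₗ[R] J := (Injective.ι (ModuleCat.of R M)).hom
  have hj : Function.Injective j := (ModuleCat.mono_iff_injective _).1 inferInstance
  have hJ : Module.Injective R J := Module.injective_module_of_injective_object R J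
    (inj := inferInstanceAs (CategoryTheory.Injective (Injective.under (ModuleCat.of R M))))
  let S : Set (Submodule R J) := {N | LinearMap.range j ≤ N ∧
    ∀ K : Submodule R J, K ≤ N → K ⊓ LinearMap.range j = ⊥ → K = ⊥}
  have hS0 : LinearMap.range j ∈ S := ⟨le_rfl, fun K hK h => by rwa [inf_eq_left.2 hK] at h⟩
  obtain ⟨N, -, hN⟩ := zorn_le_nonempty₀ S (fun c hc hchain y hy => by
    refine ⟨sSup c, ⟨(hc hy).1.trans (le_sSup hy), fun K hK h => ?_⟩, fun z hz => le_sSup hz⟩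
    rw [Submodule.eq_bot_iff]
    intro x hx
    obtain ⟨Ni, hNi, hxi⟩ :=
      (Submodule.mem_sSup_of_directed ⟨y, hy⟩ hchain.directedOn).1 (hK hx)
    have h1 := (hc hNi).2 (K ⊓ Ni) inf_le_right
      (le_bot_iff.1 ((inf_le_inf_right _ inf_le_left).trans h.le))
    have : x ∈ K ⊓ Ni := ⟨hx, hxi⟩
    rwa [h1, Submodule.mem_bot] at this) _ hS0
  obtain ⟨hNS, hNmax⟩ := hN
  obtain ⟨K, -, hK⟩ := zorn_le_nonempty₀ {K : Submodule R J | K ⊓ N = ⊥}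
    (fun c hc hchain y hy => by
      refine ⟨sSup c, ?_, fun z hz => le_sSup hz⟩
      change sSup c ⊓ N = ⊥
      rw [Submodule.eq_bot_iff]
      rintro x ⟨hx, hxN⟩
      obtain ⟨Ki, hKi, hxi⟩ := (Submodule.mem_sSup_of_directed ⟨y, hy⟩ hchain.directedOn).1 hx
      have h1 : Ki ⊓ N = ⊥ := hc hKi
      have : x ∈ Ki ⊓ N := ⟨hxi, hxN⟩
      rwa [h1, Submodule.mem_bot] at this) ⊥ (by simp)
  obtain ⟨hK0, hKmax⟩ := hK
  change K ⊓ N = ⊥ at hK0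
  let q : N →ₗ[R] (J ⧸ K) := K.mkQ ∘ₗ N.subtype
  have hq : Function.Injective q := by
    rw [← LinearMap.ker_eq_bot, Submodule.eq_bot_iff]
    intro x hx
    have hxK : (x : J) ∈ K := by simpa [q] using hx
    have : (x : J) ∈ K ⊓ N := ⟨hxK, x.2⟩
    rw [hK0, Submodule.mem_bot] at this
    exact Subtype.ext this
  obtain ⟨g, hg⟩ := hJ.out q hq N.subtype
  -- `N` is essential in `J ⧸ K`
  have hess : ∀ L : Submodule R (J ⧸ K), L ⊓ LinearMap.range q = ⊥ → L = ⊥ := by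
    intro L hL
    have h1 : L.comap K.mkQ ⊓ N = ⊥ := by
      rw [Submodule.eq_bot_iff]
      rintro x ⟨hx, hxN⟩
      have h2 : q ⟨x, hxN⟩ ∈ L ⊓ LinearMap.range q := ⟨hx, ⟨x, hxN⟩, rfl⟩
      rw [hL, Submodule.mem_bot] at h2
      have := hq (h2.trans (map_zero q).symm)
      exact congrArg Subtype.val this
    have h2 : K ≤ L.comap K.mkQ := Submodule.le_comap_mkQ K L
    have h3 := hKmax (y := L.comap K.mkQ) h1 h2
    rw [Submodule.eq_bot_iff]
    intro y hy
    obtain ⟨x, rfl⟩ := K.mkQ_surjective y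
    exact (Submodule.Quotient.mk_eq_zero K).2 (h3 hy)
  have hginj : LinearMap.ker g = ⊥ := hess _ (by
    rw [Submodule.eq_bot_iff]
    rintro _ ⟨hy, x, rfl⟩
    have : (x : J) = 0 := (hg x).symm.trans hy
    rw [show x = 0 from Subtype.ext this, map_zero])
  have hNg : N ≤ LinearMap.range g := fun x hx => ⟨q ⟨x, hx⟩, hg ⟨x, hx⟩⟩
  have hgN : LinearMap.range g ≤ N := hNmax (y := LinearMap.range g) ⟨hNS.1.trans hNg, by
    intro L hL h
    have h1 : L ⊓ N = ⊥ := hNS.2 _ inf_le_right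
      (le_bot_iff.1 ((inf_le_inf_right _ inf_le_left).trans h.le))
    have h2 : L.comap g = ⊥ := hess _ (by
      rw [Submodule.eq_bot_iff]
      rintro _ ⟨hy, x, rfl⟩
      have hy' : (x : J) ∈ L ⊓ N := ⟨by simpa [hg x] using hy, x.2⟩
      rw [h1, Submodule.mem_bot] at hy'
      rw [show x = 0 from Subtype.ext hy', map_zero])
    rw [Submodule.eq_bot_iff]
    intro x hx
    obtain ⟨y, rfl⟩ := hL hx
    have hy : y ∈ L.comap g := hx
    rw [h2, Submodule.mem_bot] at hy
    rw [hy, map_zero]⟩ hNg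
  let r : J →ₗ[R] N := (g ∘ₗ K.mkQ).codRestrict N (fun x => hgN ⟨_, rfl⟩)
  have hr : ∀ x : N, r x = x := fun x => Subtype.ext (hg x)
  refine ⟨ModuleCat.of R N, j.codRestrict N (fun x => hNS.1 ⟨x, rfl⟩), ⟨⟨?_⟩, ?_, ?_⟩⟩
  · intro X Y _ _ _ _ f hf k
    obtain ⟨h, hh⟩ := hJ.out f hf (N.subtype ∘ₗ k)
    exact ⟨r ∘ₗ h, fun x => by
      rw [LinearMap.comp_apply, hh]
      exact hr (k x)⟩
  · intro x y hxy
    exact hj (congrArg Subtype.val hxy)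
  · intro L hL
    change Submodule R N at L
    have h1 : L.map N.subtype = ⊥ := hNS.2 _ (Submodule.map_subtype_le N L) (by
      rw [Submodule.eq_bot_iff]
      rintro _ ⟨⟨x, hx, rfl⟩, m, hm⟩
      have h2 : x ∈ L ⊓ LinearMap.range (j.codRestrict N (fun x => hNS.1 ⟨x, rfl⟩)) :=
        ⟨hx, m, Subtype.ext hm⟩
      rw [show L ⊓ LinearMap.range (j.codRestrict N (fun x => hNS.1 ⟨x, rfl⟩)) = ⊥ from hL,
        Submodule.mem_bot] at h2
      rw [h2, map_zero])
    rw [Submodule.eq_bot_iff]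
    intro x hx
    exact Subtype.ext ((Submodule.eq_bot_iff _).1 h1 x ⟨x, hx, rfl⟩)

end Hull

section Cogenerator

variable (R : Type u) [CommRing R]

/-- Every nonzero element of every module is detected by a homomorphism to `E`. -/
def IsCogenerator (E : Type u) [AddCommGroup E] [Module R E] : Prop :=
  ∀ (M : Type u) [AddCommGroup M] [Module R M] (x : M), x ≠ 0 → ∃ f : M →ₗ[R] E, f x ≠ 0

/-- `E` is an injective cogenerator, and no proper submodule of `E` is one. -/
structure IsMinimalInjectiveCogenerator (E : Type u) [AddCommGroup E] [Module R E] : Prop where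
  isInjective : Module.Injective R E
  isCogenerator : IsCogenerator R E
  minimal : ∀ N : Submodule R E, Module.Injective R N → IsCogenerator R N → N = ⊤

/-- The direct sum of one copy of each simple `R`-module. -/
abbrev SimpleSum : Type u :=
  DirectSum (MaximalSpectrum R) fun 𝔪 => R ⧸ 𝔪.asIdeal

/-- The minimal injective cogenerator `E` of `R`: the injective envelope of the direct sum of
one copy of each simple `R`-module. -/
def minInjCogenerator : ModuleCat.{u} R :=
  (exists_injectiveHull (R := R) (SimpleSum R)).choose

/-- The inclusion of the simple modules in `E`. -/
def minInjCogeneratorι : SimpleSum R →ₗ[R] minInjCogenerator R :=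
  (exists_injectiveHull (R := R) (SimpleSum R)).choose_spec.choose

theorem isInjectiveHull_minInjCogeneratorι : IsInjectiveHull (minInjCogeneratorι R) :=
  (exists_injectiveHull (R := R) (SimpleSum R)).choose_spec.choose_spec

theorem isMinimalInjectiveCogenerator_minInjCogenerator :
    IsMinimalInjectiveCogenerator R (minInjCogenerator R) := by
  classical
  have hE := isInjectiveHull_minInjCogeneratorι R
  set ι := minInjCogeneratorι R
  refine ⟨hE.isInjective, ?_, ?_⟩
  · intro M _ _ x hx
    have hann : Ideal.torsionOf R M x ≠ ⊤ := by
      rwa [Ne, Ideal.torsionOf_eq_top_iff]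
    obtain ⟨𝔪, h𝔪, hle⟩ := Ideal.exists_le_maximal _ hann
    let e := Ideal.quotTorsionOfEquivSpanSingleton R M x
    let p : (R ⧸ Ideal.torsionOf R M x) →ₗ[R] (R ⧸ 𝔪) := Submodule.factor hle
    let i : (R ⧸ 𝔪) →ₗ[R] SimpleSum R :=
      DirectSum.lof R (MaximalSpectrum R) (fun 𝔪 => R ⧸ 𝔪.asIdeal) ⟨𝔪, h𝔪⟩
    have hi : Function.Injective i :=
      DirectSum.of_injective (β := fun 𝔪 : MaximalSpectrum R => R ⧸ 𝔪.asIdeal) ⟨𝔪, h𝔪⟩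
    obtain ⟨g, hg⟩ := hE.isInjective.out (Submodule.span R {x}).subtype
      (Submodule.subtype_injective _) (ι ∘ₗ i ∘ₗ p ∘ₗ e.symm.toLinearMap)
    refine ⟨g, fun h0 => ?_⟩
    have h1 := hg ⟨x, Submodule.mem_span_singleton_self x⟩
    have h2 : e (Submodule.Quotient.mk 1) = ⟨x, Submodule.mem_span_singleton_self x⟩ := by
      apply Subtype.ext
      simpa [e] using congrArg Subtype.val (Ideal.quotTorsionOfEquivSpanSingleton_apply_mk x (1 : R))
    rw [← h2] at h1
    have h3 : ι (i (p (Submodule.Quotient.mk 1))) = 0 := by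
      have h4 : g ((e (Submodule.Quotient.mk 1) : Submodule.span R {x}) : M) = 0 := by
        rw [h2]; exact h0
      have h5 := h1.symm.trans h4
      simpa using h5
    have h4 : p (Submodule.Quotient.mk 1) = 0 :=
      hi ((hE.mono (h3.trans (map_zero ι).symm)).trans (map_zero i).symm)
    exact h𝔪.ne_top ((Ideal.eq_top_iff_one _).2 ((Submodule.Quotient.mk_eq_zero 𝔪).1 h4))
  · intro N hNinj hNcog
    -- `N` contains every simple summand
    have hι : LinearMap.range ι ≤ N := by
      rintro _ ⟨s, rfl⟩
      induction s using DirectSum.induction_on with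
      | zero => simp
      | add x y hx hy => rw [map_add]; exact N.add_mem hx hy
      | of 𝔪 a =>
        have h𝔪 := 𝔪.isMaximal
        have : Nontrivial (R ⧸ 𝔪.asIdeal) := Ideal.Quotient.nontrivial_iff.2 h𝔪.ne_top
        obtain ⟨f, hf⟩ := hNcog (R ⧸ 𝔪.asIdeal) (1 : R ⧸ 𝔪.asIdeal) one_ne_zero
        let f' : (R ⧸ 𝔪.asIdeal) →ₗ[R] minInjCogenerator R := N.subtype ∘ₗ f
        have hne : LinearMap.range f' ⊓ LinearMap.range ι ≠ ⊥ := fun h => by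
          have h1 := hE.essential _ h
          rw [Submodule.eq_bot_iff] at h1
          exact hf (Subtype.ext (h1 _ ⟨1, rfl⟩))
        obtain ⟨y, ⟨⟨b, hb⟩, ⟨t, ht⟩⟩, hy0⟩ := Submodule.exists_mem_ne_zero_of_ne_bot hne
        have hyN : y ∈ N := by rw [← hb]; exact (f b).2
        have hkill : ∀ r ∈ 𝔪.asIdeal, r • t = 0 := fun r hr => by
          apply hE.mono
          rw [map_smul, ht, ← hb, ← map_smul, map_zero]
          have : r • b = 0 := by
            obtain ⟨b, rfl⟩ := Ideal.Quotient.mk_surjective b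
            rw [Algebra.smul_def]
            exact (congrArg (· * _) (Ideal.Quotient.eq_zero_iff_mem.2 hr)).trans (zero_mul _)
          rw [this, map_zero]
        have htc : ∀ 𝔫 : MaximalSpectrum R, 𝔫 ≠ 𝔪 → t 𝔫 = 0 := fun 𝔫 hn => by
          have h𝔫 := 𝔫.isMaximal
          have hnle : ¬ 𝔪.asIdeal ≤ 𝔫.asIdeal := fun hle =>
            hn (MaximalSpectrum.ext (h𝔪.eq_of_le h𝔫.ne_top hle).symm)
          obtain ⟨r, hr, hrn⟩ := Set.not_subset.1 hnle
          have h1 : r • t 𝔫 = 0 := by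
            rw [← DirectSum.smul_apply, hkill r hr]; rfl
          obtain ⟨c, hc⟩ := Ideal.Quotient.mk_surjective (t 𝔫)
          rw [← hc] at h1 ⊢
          rw [Ideal.Quotient.eq_zero_iff_mem]
          have h2 : Ideal.Quotient.mk 𝔫.asIdeal (r * c) = 0 := by
            rw [map_mul]; rw [Algebra.smul_def] at h1; exact h1
          rw [Ideal.Quotient.eq_zero_iff_mem] at h2
          exact (h𝔫.isPrime.mem_or_mem h2).resolve_left hrn
        have ht' : t = DirectSum.of (fun 𝔪 : MaximalSpectrum R => R ⧸ 𝔪.asIdeal) 𝔪 (t 𝔪) := by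
          refine DFinsupp.ext fun 𝔫 => ?_
          by_cases h : 𝔫 = 𝔪
          · subst h; exact (DirectSum.of_eq_same (β := fun 𝔪 : MaximalSpectrum R => R ⧸ 𝔪.asIdeal) _ _).symm
          · rw [show t 𝔫 = 0 from htc 𝔫 h]
            exact (DirectSum.of_eq_of_ne (β := fun 𝔪 : MaximalSpectrum R => R ⧸ 𝔪.asIdeal)
              _ _ _ h).symm
        have htm : t 𝔪 ≠ 0 := fun h => hy0 (by rw [← ht, ht', h, map_zero, map_zero])
        let _ := Ideal.Quotient.field 𝔪.asIdeal
        obtain ⟨c, hc⟩ := Ideal.Quotient.mk_surjective (a * (t 𝔪)⁻¹)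
        have hca : c • t 𝔪 = a := by
          rw [Algebra.smul_def]
          change Ideal.Quotient.mk 𝔪.asIdeal c * t 𝔪 = a
          rw [hc, mul_assoc, inv_mul_cancel₀ htm, mul_one]
        have hcs : DirectSum.of (fun 𝔪 : MaximalSpectrum R => R ⧸ 𝔪.asIdeal) 𝔪 a = c • t := by
          conv_rhs => rw [ht']
          rw [← hca]
          exact (DirectSum.lof R (MaximalSpectrum R) (fun 𝔪 => R ⧸ 𝔪.asIdeal) 𝔪).map_smul c _
        rw [hcs, map_smul, ht]
        exact N.smul_mem c hyN
    obtain ⟨r, hr⟩ := hNinj.out N.subtype N.subtype_injective LinearMap.id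
    have hker : LinearMap.ker r = ⊥ := hE.essential _ (by
      rw [Submodule.eq_bot_iff]
      rintro x ⟨hx, hxι⟩
      have h1 := hr ⟨x, hι hxι⟩
      exact congrArg Subtype.val (h1.symm.trans hx))
    rw [Submodule.eq_top_iff']
    intro x
    have h1 : r x = r (r x : minInjCogenerator R) := (hr (r x)).symm
    have h2 := LinearMap.ker_eq_bot.1 hker h1
    rw [h2]
    exact (r x).2

end Cogenerator

/-! ### Gorenstein homological algebra over a ring -/

/-- The left `A`-module `DA = Hom_R(A, E)`, with `(a • f) x = f (x * a)`. -/
def dualModule (R A : Type u) [CommRing R] [Ring A] [Algebra R A] : ModuleCat.{u} A :=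
  (ModuleCat.coextendScalars (algebraMap R A)).obj (minInjCogenerator R)

section Classes

variable (A : Type u) [Ring A]

/-- `A` has injective dimension at most `d` as a left and as a right module over itself. -/
def IsGorensteinLE (d : ℕ) : Prop :=
  HasInjectiveDimensionLE (ModuleCat.of A A) d ∧ HasInjectiveDimensionLE (ModuleCat.of Aᵐᵒᵖ A) d

variable {A}

/-- An acyclic complex of projective modules whose Hom complex `Hom(P, Q)` is acyclic for every
projective module `Q`. -/
structure IsTotallyAcyclic (P : CochainComplex (ModuleCat.{u} A) ℤ) : Prop where
  projective : ∀ n, Projective (P.X n)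
  acyclic : P.Acyclic
  hom_acyclic : ∀ Q : ModuleCat.{u} A, Projective Q →
    ∀ (n : ℤ) (f : P.X n ⟶ Q), P.d (n - 1) n ≫ f = 0 →
      ∃ g : P.X (n + 1) ⟶ Q, P.d n (n + 1) ≫ g = f

/-- An acyclic complex of injective modules whose Hom complex `Hom(J, I)` is acyclic for every
injective module `J`. -/
structure IsCototallyAcyclic (I : CochainComplex (ModuleCat.{u} A) ℤ) : Prop where
  injective : ∀ n, Injective (I.X n)
  acyclic : I.Acyclic
  hom_acyclic : ∀ J : ModuleCat.{u} A, Injective J →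
    ∀ (n : ℤ) (f : J ⟶ I.X n), f ≫ I.d n (n + 1) = 0 →
      ∃ g : J ⟶ I.X (n - 1), g ≫ I.d (n - 1) n = f

variable (A)

/-- Gorenstein-projective modules: zeroth cocycles of totally acyclic complexes. -/
def GProj : ObjectProperty (ModuleCat.{u} A) := fun M =>
  ∃ P : CochainComplex (ModuleCat.{u} A) ℤ, IsTotallyAcyclic P ∧
    Nonempty (M ≃ₗ[A] LinearMap.ker (P.d 0 1).hom)

/-- Gorenstein-injective modules: zeroth coboundaries of cototally acyclic complexes. -/
def GInj : ObjectProperty (ModuleCat.{u} A) := fun N =>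
  ∃ I : CochainComplex (ModuleCat.{u} A) ℤ, IsCototallyAcyclic I ∧
    Nonempty (N ≃ₗ[A] LinearMap.range (I.d (-1) 0).hom)

variable {A}

/-- `IsSyzygy d M K`: the module `K` is a `d`-th syzygy of `M`, i.e. there is an exact sequence
`0 → K → P_{d-1} → ⋯ → P_0 → M → 0` with all `P_i` projective. -/
def IsSyzygy : ℕ → ModuleCat.{u} A → ModuleCat.{u} A → Prop
  | 0, M, K => Nonempty (M ≅ K)
  | d + 1, M, K => ∃ S : ShortComplex (ModuleCat.{u} A), S.ShortExact ∧ Projective S.X₂ ∧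
      Nonempty (S.X₁ ≅ K) ∧ IsSyzygy d M S.X₃

/-- `IsCosyzygy d M K`: the module `K` is a `d`-th cosyzygy of `M`, i.e. there is an exact sequence
`0 → M → I^0 → ⋯ → I^{d-1} → K → 0` with all `I^i` injective. -/
def IsCosyzygy : ℕ → ModuleCat.{u} A → ModuleCat.{u} A → Prop
  | 0, M, K => Nonempty (M ≅ K)
  | d + 1, M, K => ∃ S : ShortComplex (ModuleCat.{u} A), S.ShortExact ∧ Injective S.X₂ ∧
      Nonempty (S.X₃ ≅ K) ∧ IsCosyzygy d M S.X₁

variable (A)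

/-- The class `Ω^d(A-Mod)` of all `d`-th syzygies. -/
def syzygies (d : ℕ) : ObjectProperty (ModuleCat.{u} A) := fun K => ∃ M, IsSyzygy d M K

/-- The class `Ω^{-d}(A-Mod)` of all `d`-th cosyzygies. -/
def cosyzygies (d : ℕ) : ObjectProperty (ModuleCat.{u} A) := fun K => ∃ M, IsCosyzygy d M K

/-- The modules of projective dimension at most `d`. -/
def projDimLE (d : ℕ) : ObjectProperty (ModuleCat.{u} A) := fun M => HasProjectiveDimensionLE M d

/-- The modules of injective dimension at most `d`. -/
def injDimLE (d : ℕ) : ObjectProperty (ModuleCat.{u} A) := fun M => HasInjectiveDimensionLE M d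

/-- The modules `M` with `Ext^i(M, T) = 0` for all `i ≥ 1`. -/
def leftPerp (T : ModuleCat.{u} A) : ObjectProperty (ModuleCat.{u} A) := fun M =>
  ∀ i : ℕ, 1 ≤ i → Subsingleton (Abelian.Ext M T i)

/-- The modules `M` with `Ext^i(T, M) = 0` for all `i ≥ 1`. -/
def rightPerp (T : ModuleCat.{u} A) : ObjectProperty (ModuleCat.{u} A) := fun M =>
  ∀ i : ℕ, 1 ≤ i → Subsingleton (Abelian.Ext T M i)

end Classes

/-- A (complete) cotorsion pair of full additive subcategories of an abelian category. -/
structure IsCotorsionPair {C : Type u} [Category.{v} C] [Abelian C] [HasExt.{w} C]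
    (F G : ObjectProperty C) : Prop where
  left_additive : F.IsClosedUnderFiniteProducts
  right_additive : G.IsClosedUnderFiniteProducts
  left_summand : F.IsStableUnderRetracts
  right_summand : G.IsStableUnderRetracts
  ext_eq_zero : ∀ X Y : C, F X → G Y → Subsingleton (Abelian.Ext X Y 1)
  left_approx : ∀ M : C, ∃ S : ShortComplex C, S.ShortExact ∧ G S.X₁ ∧ F S.X₂ ∧ Nonempty (S.X₃ ≅ M)
  right_approx : ∀ M : C, ∃ S : ShortComplex C, S.ShortExact ∧ Nonempty (S.X₁ ≅ M) ∧ G S.X₂ ∧ F S.X₃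

end GorensteinArtin

end

/-!
`A` is `d`-Gorenstein if and only if in `A`-Mod all projectives have injective dimension at most `d`
and all injectives have projective dimension at most `d`: projectives are summands of a direct sum
of copies of `A`, which by Matlis duality is itself a summand of a product of copies of `A`;
injectives are summands of a direct sum of copies of `DA`, as `A` is artinian; and the injective
dimension of `A` as a right module is the projective dimension of `DA = Hom_R(A, E)`, because
`Hom_A(-, DA)` is exact and dualizes.

For an abelian category this pair of conditions is equivalent to every `d`-th syzygy being
Gorenstein-projective. It is invariant under passing to the opposite category, which exchanges
Gorenstein-projective and Gorenstein-injective objects, so only one half of each claim is proved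
directly. A Gorenstein-projective object is treated as a member of a two-sided sequence of objects
in `⊥Proj`, each a first syzygy of the next; the horseshoe lemma supplies the steps to the right.
-/

universe w'

noncomputable section

namespace GorensteinArtin

open Limits Opposite

section ShortExact

variable {C : Type u} [Category.{v} C] [Abelian C] {X Y Z : C}

/-- `0 ⟶ X ⟶ Y ⟶ Z ⟶ 0` is exact. Unlike `ShortComplex.ShortExact`, the predicate leaves the
three objects unbundled, so that syzygies are prescribed objects and not objects up to isomorphism.
-/
def IsShortExact (f : X ⟶ Y) (g : Y ⟶ Z) : Prop :=
  ∃ zero : f ≫ g = 0, (ShortComplex.mk f g zero).ShortExact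

theorem isShortExact_of_shortExact {S : ShortComplex C} (hS : S.ShortExact) :
    IsShortExact S.f S.g :=
  ⟨S.zero, hS⟩

theorem isShortExact_kernel_ι (g : Y ⟶ Z) [Epi g] : IsShortExact (kernel.ι g) g :=
  ⟨kernel.condition g, ShortComplex.ShortExact.mk (ShortComplex.exact_kernel g)⟩

theorem isShortExact_cokernel_π (f : X ⟶ Y) [Mono f] : IsShortExact f (cokernel.π f) :=
  ⟨cokernel.condition f, ShortComplex.ShortExact.mk (ShortComplex.exact_cokernel f)⟩

namespace IsShortExact

theorem of_exists_lift {f : X ⟶ Y} {g : Y ⟶ Z} [Mono f] [Epi g] (zero : f ≫ g = 0)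
    (h : ∀ ⦃T : C⦄ (t : T ⟶ Y), t ≫ g = 0 → ∃ s, s ≫ f = t) : IsShortExact f g := by
  refine ⟨zero, ShortComplex.ShortExact.mk
    ((ShortComplex.exact_iff_exact_up_to_refinements _).2 fun T t ht => ?_)⟩
  obtain ⟨s, hs⟩ := h t ht
  exact ⟨T, 𝟙 T, inferInstance, s, by simpa using hs.symm⟩

variable {f : X ⟶ Y} {g : Y ⟶ Z} (h : IsShortExact f g)

include h

theorem zero : f ≫ g = 0 := h.1

theorem mono : Mono f := h.2.mono_f

theorem epi : Epi g := h.2.epi_g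

theorem exists_lift {T : C} (t : T ⟶ Y) (ht : t ≫ g = 0) : ∃ s, s ≫ f = t := by
  have := h.mono
  exact ⟨h.2.exact.lift t ht, h.2.exact.lift_f t ht⟩

theorem op : IsShortExact g.op f.op := ⟨congrArg Quiver.Hom.op h.zero, h.2.op⟩

theorem exists_desc {T : C} (t : Y ⟶ T) (ht : f ≫ t = 0) : ∃ s, g ≫ s = t := by
  obtain ⟨s, hs⟩ := h.op.exists_lift t.op (congrArg Quiver.Hom.op ht)
  exact ⟨s.unop, congrArg Quiver.Hom.unop hs⟩

theorem comp_iso {X' Z' : C} (eX : X ≅ X') (eZ : Z ≅ Z') :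
    IsShortExact (eX.inv ≫ f) (g ≫ eZ.hom) := by
  have zero : (eX.inv ≫ f) ≫ g ≫ eZ.hom = 0 := by simp [reassoc_of% h.zero]
  exact ⟨zero, ShortComplex.shortExact_of_iso
    (ShortComplex.isoMk eX (Iso.refl Y) eZ : ShortComplex.mk f g h.zero ≅ .mk _ _ zero) h.2⟩

omit h in
theorem unop {X Y Z : Cᵒᵖ} {f : X ⟶ Y} {g : Y ⟶ Z} (h : IsShortExact f g) :
    IsShortExact g.unop f.unop :=
  ⟨congrArg Quiver.Hom.unop h.zero, h.2.unop⟩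

/-- The preimage `W` of the subobject `X` under an epimorphism `P ⟶ Y`. -/
theorem exists_preimage {L P : C} {k : L ⟶ P} {p : P ⟶ Y} (hP : IsShortExact k p) :
    ∃ (W : C) (a : L ⟶ W) (b : W ⟶ X) (c : W ⟶ P),
      IsShortExact a b ∧ IsShortExact c (p ≫ g) := by
  have := h.mono
  have := h.epi
  have := hP.mono
  have := hP.epi
  let c := kernel.ι (p ≫ g)
  obtain ⟨b, hb⟩ := h.exists_lift (c ≫ p) (by simp [c])
  let a : L ⟶ kernel (p ≫ g) := kernel.lift _ k (by simp [reassoc_of% hP.zero])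
  have hac : a ≫ c = k := kernel.lift_ι ..
  have : Mono a := mono_of_mono_fac hac
  have : Epi b := by
    rw [epi_iff_surjective_up_to_refinements]
    intro T x
    obtain ⟨T', π, hπ, y, hy⟩ := surjective_up_to_refinements_of_epi p (x ≫ f)
    refine ⟨T', π, hπ, kernel.lift _ y (by simp [← reassoc_of% hy, h.zero]), ?_⟩
    simp [← cancel_mono f, hb, c, hy]
  refine ⟨_, a, b, c, of_exists_lift ?_ fun T t ht => ?_, isShortExact_kernel_ι _⟩
  · simp [← cancel_mono f, hb, reassoc_of% hac, hP.zero]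
  · obtain ⟨s, hs⟩ := hP.exists_lift (t ≫ c) (by simp [← hb, reassoc_of% ht])
    exact ⟨s, by simp [← cancel_mono c, hac, hs]⟩

theorem exists_lift_up_to_refinements {Q T : C} (q : Q ⟶ X) [Epi q] (y : T ⟶ Y) (hy : y ≫ g = 0) :
    ∃ (T' : C) (π : T' ⟶ T) (_ : Epi π) (t : T' ⟶ Q), π ≫ y = t ≫ q ≫ f := by
  obtain ⟨x, hx⟩ := h.exists_lift y hy
  obtain ⟨T', π, hπ, t, ht⟩ := surjective_up_to_refinements_of_epi q x
  exact ⟨T', π, hπ, t, by simp [← reassoc_of% ht, hx]⟩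

/-- The horseshoe lemma: `J` is the kernel of the epimorphism `Q ⊞ P ⟶ Y`, and `s` is the only
place where the projectivity of `P` would enter. -/
theorem exists_horseshoe {K Q L P : C} {k : K ⟶ Q} {q : Q ⟶ X} {l : L ⟶ P} {s : P ⟶ Y}
    (hX : IsShortExact k q) (hZ : IsShortExact l (s ≫ g)) :
    ∃ (J : C) (a : K ⟶ J) (b : J ⟶ L) (c : J ⟶ Q ⊞ P) (d : Q ⊞ P ⟶ Y),
      IsShortExact a b ∧ IsShortExact c d := by
  have := h.mono
  have := hX.mono
  have := hX.epi
  have := hZ.mono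
  have := hZ.epi
  let d : Q ⊞ P ⟶ Y := biprod.desc (q ≫ f) s
  let c := kernel.ι d
  have hc : (c ≫ biprod.fst) ≫ q ≫ f + (c ≫ biprod.snd) ≫ s = 0 := by
    simpa [d, biprod.desc_eq] using kernel.condition d
  have : Epi d := by
    rw [epi_iff_surjective_up_to_refinements]
    intro T y
    obtain ⟨T', π, hπ, t, ht⟩ := surjective_up_to_refinements_of_epi (s ≫ g) (y ≫ g)
    obtain ⟨T'', π', hπ', t', ht'⟩ := h.exists_lift_up_to_refinements q (π ≫ y - t ≫ s)
      (by simp [ht])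
    exact ⟨T'', π' ≫ π, epi_comp _ _, biprod.lift t' (π' ≫ t), by
      simp [d, ← ht']⟩
  obtain ⟨b, hb⟩ := hZ.exists_lift (c ≫ biprod.snd) (by
    simpa [h.zero] using congrArg (· ≫ g) hc)
  let a : K ⟶ kernel d := kernel.lift d (k ≫ biprod.inl) (by simp [d, reassoc_of% hX.zero])
  have hac : a ≫ c = k ≫ biprod.inl := kernel.lift_ι ..
  have : Mono a := mono_of_mono_fac hac
  have : Epi b := by
    rw [epi_iff_surjective_up_to_refinements]
    intro T t
    obtain ⟨T', π, hπ, t', ht'⟩ := h.exists_lift_up_to_refinements q (t ≫ l ≫ s)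
      (by simp [hZ.zero])
    refine ⟨T', π, hπ, kernel.lift d (biprod.lift (-t') (π ≫ t ≫ l)) (by simp [d, ht']), ?_⟩
    simp [← cancel_mono l, hb, c]
  refine ⟨_, a, b, c, d, of_exists_lift ?_ fun T t ht => ?_, isShortExact_kernel_ι d⟩
  · simp [← cancel_mono l, hb, reassoc_of% hac]
  · have ht_snd : t ≫ c ≫ biprod.snd = 0 := by rw [← hb, reassoc_of% ht, zero_comp]
    obtain ⟨r, hr⟩ := hX.exists_lift (t ≫ c ≫ biprod.fst) (by
      simpa [← cancel_mono f, reassoc_of% ht_snd] using t ≫= hc)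
    refine ⟨r, ?_⟩
    rw [← cancel_mono c, Category.assoc, hac, reassoc_of% hr]
    ext <;> simp [ht_snd]

end IsShortExact

end ShortExact

namespace IsShortExact

variable {C : Type u} [Category.{v} C] [Abelian C] {X Y Z : C}

theorem of_exists_desc {f : X ⟶ Y} {g : Y ⟶ Z} [Mono f] [Epi g] (zero : f ≫ g = 0)
    (h : ∀ ⦃T : C⦄ (t : Y ⟶ T), f ≫ t = 0 → ∃ s, g ≫ s = t) : IsShortExact f g := by
  refine (of_exists_lift (f := g.op) (g := f.op) (congrArg Quiver.Hom.op zero)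
    fun T t ht => ?_).unop
  obtain ⟨s, hs⟩ := h t.unop (congrArg Quiver.Hom.unop ht)
  exact ⟨s.op, congrArg Quiver.Hom.op hs⟩

theorem exists_of_isPushout {f : X ⟶ Y} {g : Y ⟶ Z} (h : IsShortExact f g) {P W : C} {k : X ⟶ P}
    {i : Y ⟶ W} {j : P ⟶ W} (sq : IsPushout f k i j) : ∃ q : W ⟶ Z, IsShortExact j q := by
  have := h.mono
  have := h.epi
  have : Mono j := MorphismProperty.of_isPushout (P := .monomorphisms C) sq.flip ‹Mono f›
  obtain ⟨q, hiq, hjq⟩ : ∃ q : W ⟶ Z, i ≫ q = g ∧ j ≫ q = 0 :=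
    ⟨sq.desc g 0 (by simp [h.zero]), sq.inl_desc .., sq.inr_desc ..⟩
  have : Epi q := epi_of_epi_fac hiq
  refine ⟨q, of_exists_desc hjq fun T t ht => ?_⟩
  obtain ⟨s, hs⟩ := h.exists_desc (i ≫ t) (by simp [sq.w_assoc, ht])
  exact ⟨s, sq.hom_ext (by simp [reassoc_of% hiq, hs]) (by simp [reassoc_of% hjq, ht])⟩

end IsShortExact

section Ext

variable {C : Type u} [Category.{v} C] [Abelian C] [HasExt.{w} C]

open Abelian

section LongExactSequence

variable {X Y Z : C} {f : X ⟶ Y} {g : Y ⟶ Z} (h : IsShortExact f g) {T : C} {i : ℕ}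

include h

theorem subsingleton_ext_from_left (hY : Subsingleton (Ext Y T i))
    (hZ : Subsingleton (Ext Z T (i + 1))) : Subsingleton (Ext X T i) := by
  refine subsingleton_of_forall_eq 0 fun x => ?_
  obtain ⟨y, rfl⟩ := Ext.contravariant_sequence_exact₁ h.2 T x (add_comm 1 i)
    (hZ.elim _ _)
  rw [hY.elim y 0, Ext.comp_zero]

theorem subsingleton_ext_from_middle (hX : Subsingleton (Ext X T i))
    (hZ : Subsingleton (Ext Z T i)) : Subsingleton (Ext Y T i) := by
  refine subsingleton_of_forall_eq 0 fun x => ?_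
  obtain ⟨y, rfl⟩ := Ext.contravariant_sequence_exact₂ h.2 T x (hX.elim _ _)
  rw [hZ.elim y 0, Ext.comp_zero]

theorem subsingleton_ext_from_right (hX : Subsingleton (Ext X T i))
    (hY : Subsingleton (Ext Y T (i + 1))) : Subsingleton (Ext Z T (i + 1)) := by
  refine subsingleton_of_forall_eq 0 fun x => ?_
  obtain ⟨y, rfl⟩ := Ext.contravariant_sequence_exact₃ h.2 T x (hY.elim _ _) (add_comm 1 i)
  rw [hX.elim y 0, Ext.comp_zero]

theorem subsingleton_ext_to_left (hY : Subsingleton (Ext T Y (i + 1)))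
    (hZ : Subsingleton (Ext T Z i)) : Subsingleton (Ext T X (i + 1)) := by
  refine subsingleton_of_forall_eq 0 fun x => ?_
  obtain ⟨y, rfl⟩ := Ext.covariant_sequence_exact₁ T h.2 x (hY.elim _ _) rfl
  rw [hZ.elim y 0, Ext.zero_comp]

theorem subsingleton_ext_to_middle (hX : Subsingleton (Ext T X i))
    (hZ : Subsingleton (Ext T Z i)) : Subsingleton (Ext T Y i) := by
  refine subsingleton_of_forall_eq 0 fun x => ?_
  obtain ⟨y, rfl⟩ := Ext.covariant_sequence_exact₂ T h.2 x (hZ.elim _ _)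
  rw [hX.elim y 0, Ext.zero_comp]

theorem subsingleton_ext_to_right (hX : Subsingleton (Ext T X (i + 1)))
    (hY : Subsingleton (Ext T Y i)) : Subsingleton (Ext T Z i) := by
  refine subsingleton_of_forall_eq 0 fun x => ?_
  obtain ⟨y, rfl⟩ := Ext.covariant_sequence_exact₃ T h.2 x rfl (hX.elim _ _)
  rw [hY.elim y 0, Ext.zero_comp]

theorem exists_extension_of_subsingleton_ext (hZ : Subsingleton (Ext Z T 1)) (φ : X ⟶ T) :
    ∃ ψ : Y ⟶ T, f ≫ ψ = φ := by
  obtain ⟨x, hx⟩ := Ext.contravariant_sequence_exact₁ h.2 T (Ext.mk₀ φ) (add_zero 1)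
    (hZ.elim _ _)
  obtain ⟨ψ, rfl⟩ := Ext.homEquiv₀.symm.surjective x
  exact ⟨ψ, Ext.homEquiv₀.symm.injective (by simpa using hx)⟩

theorem exists_lift_of_subsingleton_ext (hX : Subsingleton (Ext T X 1)) (φ : T ⟶ Z) :
    ∃ ψ : T ⟶ Y, ψ ≫ g = φ := by
  obtain ⟨x, hx⟩ := Ext.covariant_sequence_exact₃ T h.2 (Ext.mk₀ φ) (zero_add 1)
    (hX.elim _ _)
  obtain ⟨ψ, rfl⟩ := Ext.homEquiv₀.symm.surjective x
  exact ⟨ψ, Ext.homEquiv₀.symm.injective (by simpa using hx)⟩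

end LongExactSequence

theorem subsingleton_ext_of_projective (P T : C) [Projective P] {i : ℕ} (hi : 1 ≤ i) :
    Subsingleton (Ext P T i) :=
  HasProjectiveDimensionLT.subsingleton P 1 i hi T

theorem subsingleton_ext_of_injective (T I : C) [Injective I] {i : ℕ} (hi : 1 ≤ i) :
    Subsingleton (Ext T I i) :=
  HasInjectiveDimensionLT.subsingleton I 1 i hi T

theorem subsingleton_ext_of_retract_left {X X' T : C} (r : Retract X X') {i : ℕ}
    (h : Subsingleton (Ext X' T i)) : Subsingleton (Ext X T i) := by
  refine subsingleton_of_forall_eq 0 fun x => ?_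
  rw [← x.mk₀_id_comp, ← r.retract, ← Ext.mk₀_comp_mk₀, Ext.comp_assoc_of_second_deg_zero,
    h.elim ((Ext.mk₀ r.r).comp x (zero_add i)) 0, Ext.comp_zero]

theorem subsingleton_ext_of_retract_right {X X' T : C} (r : Retract X X') {i : ℕ}
    (h : Subsingleton (Ext T X' i)) : Subsingleton (Ext T X i) := by
  refine subsingleton_of_forall_eq 0 fun x => ?_
  rw [← x.comp_mk₀_id, ← r.retract, ← Ext.mk₀_comp_mk₀, ← Ext.comp_assoc_of_third_deg_zero,
    h.elim (x.comp (Ext.mk₀ r.i) (add_zero i)) 0, Ext.zero_comp]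

theorem hasProjectiveDimensionLE_iff_subsingleton_ext {X : C} {n : ℕ} :
    HasProjectiveDimensionLE X n ↔ ∀ T i, n < i → Subsingleton (Ext X T i) :=
  ⟨fun _ T i hi => HasProjectiveDimensionLT.subsingleton X (n + 1) i hi T, fun h =>
    HasProjectiveDimensionLT.mk fun i hi T x => (h T i hi).elim x 0⟩

theorem hasInjectiveDimensionLE_iff_subsingleton_ext {X : C} {n : ℕ} :
    HasInjectiveDimensionLE X n ↔ ∀ T i, n < i → Subsingleton (Ext T X i) :=
  ⟨fun _ T i hi => HasInjectiveDimensionLT.subsingleton X (n + 1) i hi T, fun h =>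
    HasInjectiveDimensionLT.mk fun i hi T x => (h T i hi).elim x 0⟩

variable {X Y Z : C} {f : X ⟶ Y} {g : Y ⟶ Z}

theorem subsingleton_ext_shift_left [Projective Y] (h : IsShortExact f g) {T : C} {i : ℕ}
    (hi : 1 ≤ i) : Subsingleton (Ext Z T (i + 1)) ↔ Subsingleton (Ext X T i) :=
  ⟨subsingleton_ext_from_left h (subsingleton_ext_of_projective Y T hi), fun hX =>
    subsingleton_ext_from_right h hX (subsingleton_ext_of_projective Y T i.succ_pos)⟩

theorem subsingleton_ext_shift_right [Injective Y] (h : IsShortExact f g) {T : C} {i : ℕ}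
    (hi : 1 ≤ i) : Subsingleton (Ext T X (i + 1)) ↔ Subsingleton (Ext T Z i) :=
  ⟨fun hX => subsingleton_ext_to_right h hX (subsingleton_ext_of_injective T Y hi),
    subsingleton_ext_to_left h (subsingleton_ext_of_injective T Y i.succ_pos)⟩

theorem subsingleton_ext_one_iff_exists_extension [Projective Y] (h : IsShortExact f g) {T : C} :
    Subsingleton (Ext Z T 1) ↔ ∀ φ : X ⟶ T, ∃ ψ : Y ⟶ T, f ≫ ψ = φ := by
  refine ⟨exists_extension_of_subsingleton_ext h, fun hext =>
    subsingleton_of_forall_eq 0 fun x => ?_⟩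
  obtain ⟨y, rfl⟩ := Ext.contravariant_sequence_exact₃ h.2 T x
    ((subsingleton_ext_of_projective Y T le_rfl).elim _ _) (add_zero 1)
  obtain ⟨φ, rfl⟩ := Ext.homEquiv₀.symm.surjective y
  obtain ⟨ψ, rfl⟩ := hext φ
  rw [Ext.homEquiv₀_symm_apply, ← Ext.mk₀_comp_mk₀, ← Ext.comp_assoc_of_second_deg_zero,
    h.2.extClass_comp, Ext.zero_comp]

theorem subsingleton_ext_one_iff_exists_lift [Injective Y] (h : IsShortExact f g) {T : C} :
    Subsingleton (Ext T X 1) ↔ ∀ φ : T ⟶ Z, ∃ ψ : T ⟶ Y, ψ ≫ g = φ := by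
  refine ⟨exists_lift_of_subsingleton_ext h, fun hlift =>
    subsingleton_of_forall_eq 0 fun x => ?_⟩
  obtain ⟨y, rfl⟩ := Ext.covariant_sequence_exact₁ T h.2 x
    ((subsingleton_ext_of_injective T Y le_rfl).elim _ _) (zero_add 1)
  obtain ⟨φ, rfl⟩ := Ext.homEquiv₀.symm.surjective y
  obtain ⟨ψ, rfl⟩ := hlift φ
  rw [Ext.homEquiv₀_symm_apply, ← Ext.mk₀_comp_mk₀, Ext.comp_assoc_of_second_deg_zero,
    h.2.comp_extClass, Ext.comp_zero]

end Ext

section Opposite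

variable {C : Type u} [Category.{v} C] [Abelian C] [EnoughProjectives C]

open Abelian

theorem subsingleton_ext_op_iff [HasExt.{w} C] [HasExt.{w'} Cᵒᵖ] {X T : C} (i : ℕ) :
    Subsingleton (Ext (op T) (op X) i) ↔ Subsingleton (Ext X T i) := by
  induction i generalizing X with
  | zero =>
    exact (Ext.homEquiv₀.trans ((opEquiv _ _).trans Ext.homEquiv₀.symm)).subsingleton_congr
  | succ i ih =>
    have h := isShortExact_kernel_ι (Projective.π X)
    obtain rfl | hi := Nat.eq_zero_or_pos i
    · rw [subsingleton_ext_one_iff_exists_extension h, zero_add,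
        subsingleton_ext_one_iff_exists_lift h.op]
      exact (opEquiv _ _).forall_congr fun φ => (opEquiv _ _).exists_congr fun ψ =>
        Quiver.Hom.unop_inj.eq_iff.symm
    · rw [subsingleton_ext_shift_left h hi, subsingleton_ext_shift_right h.op hi, ih]

theorem hasInjectiveDimensionLE_op_iff {X : C} {n : ℕ} :
    HasInjectiveDimensionLE (op X) n ↔ HasProjectiveDimensionLE X n := by
  let _ := HasExt.standard C
  let _ := HasExt.standard Cᵒᵖ
  simp only [hasInjectiveDimensionLE_iff_subsingleton_ext,
    hasProjectiveDimensionLE_iff_subsingleton_ext, op_surjective.forall, subsingleton_ext_op_iff]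

theorem hasProjectiveDimensionLE_op_iff {X : C} {n : ℕ} :
    HasProjectiveDimensionLE (op X) n ↔ HasInjectiveDimensionLE X n := by
  let _ := HasExt.standard C
  let _ := HasExt.standard Cᵒᵖ
  simp only [hasInjectiveDimensionLE_iff_subsingleton_ext,
    hasProjectiveDimensionLE_iff_subsingleton_ext, op_surjective.forall, subsingleton_ext_op_iff]

end Opposite

section Syzygy

variable {C : Type u} [Category.{v} C] [Abelian C]

/-- `K` is a first syzygy of `M`: the kernel of an epimorphism from a projective object onto `M`. -/
def IsFirstSyzygy (M K : C) : Prop :=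
  ∃ (P : C) (f : K ⟶ P) (g : P ⟶ M), Projective P ∧ IsShortExact f g

/-- `K` is an `n`-th syzygy of `M`: the kernel of the last map of an exact sequence
`P_{n-1} ⟶ ⋯ ⟶ P_0 ⟶ M ⟶ 0` with all `P_i` projective. In the opposite category this is the
notion of an `n`-th cosyzygy. -/
def IsNthSyzygy : ℕ → C → C → Prop
  | 0, M, K => Nonempty (M ≅ K)
  | n + 1, M, K => ∃ L, IsNthSyzygy n M L ∧ IsFirstSyzygy L K

theorem IsFirstSyzygy.of_iso {M M' K K' : C} (h : IsFirstSyzygy M K) (eM : M ≅ M') (eK : K ≅ K') :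
    IsFirstSyzygy M' K' := by
  obtain ⟨P, f, g, hP, hfg⟩ := h
  exact ⟨P, _, _, hP, hfg.comp_iso eK eM⟩

theorem IsNthSyzygy.succ_of_isFirstSyzygy {M L K : C} {n : ℕ} (hL : IsFirstSyzygy M L)
    (hK : IsNthSyzygy n L K) : IsNthSyzygy (n + 1) M K := by
  induction n generalizing K with
  | zero =>
    obtain ⟨e⟩ := hK
    exact ⟨M, ⟨Iso.refl M⟩, hL.of_iso (Iso.refl M) e⟩
  | succ n ih =>
    obtain ⟨L', hL', hK⟩ := hK
    exact ⟨L', ih hL', hK⟩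

theorem IsNthSyzygy.exists_isFirstSyzygy {M K : C} {n : ℕ} (h : IsNthSyzygy (n + 1) M K) :
    ∃ L, IsFirstSyzygy M L ∧ IsNthSyzygy n L K := by
  induction n generalizing K with
  | zero =>
    obtain ⟨L, ⟨e⟩, hK⟩ := h
    exact ⟨K, hK.of_iso e.symm (Iso.refl K), ⟨Iso.refl K⟩⟩
  | succ n ih =>
    obtain ⟨L, hL, hK⟩ := h
    obtain ⟨N, hN, hNL⟩ := ih hL
    exact ⟨N, hN, L, hNL, hK⟩

section EnoughProjectives

variable [EnoughProjectives C]

theorem exists_isFirstSyzygy (M : C) : ∃ K, IsFirstSyzygy M K :=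
  ⟨_, _, _, _, inferInstance, isShortExact_kernel_ι (Projective.π M)⟩

theorem exists_isNthSyzygy (n : ℕ) (M : C) : ∃ K, IsNthSyzygy n M K := by
  induction n with
  | zero => exact ⟨M, ⟨Iso.refl M⟩⟩
  | succ n ih =>
    obtain ⟨L, hL⟩ := ih
    obtain ⟨K, hK⟩ := exists_isFirstSyzygy L
    exact ⟨K, L, hL, hK⟩

end EnoughProjectives

theorem IsFirstSyzygy.exists_horseshoe {X Y Z K L : C} {f : X ⟶ Y} {g : Y ⟶ Z}
    (h : IsShortExact f g) (hK : IsFirstSyzygy X K) (hL : IsFirstSyzygy Z L) :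
    ∃ (J : C) (a : K ⟶ J) (b : J ⟶ L), IsFirstSyzygy Y J ∧ IsShortExact a b := by
  obtain ⟨Q, k, q, hQ, hkq⟩ := hK
  obtain ⟨P, l, p, hP, hlp⟩ := hL
  have := h.epi
  rw [← Projective.factorThru_comp p g] at hlp
  obtain ⟨J, a, b, c, d, hab, hcd⟩ := h.exists_horseshoe hkq hlp
  exact ⟨J, a, b, ⟨_, c, d, inferInstance, hcd⟩, hab⟩

theorem IsNthSyzygy.exists_horseshoe {X Y Z K L : C} {f : X ⟶ Y} {g : Y ⟶ Z}
    (h : IsShortExact f g) {n : ℕ} (hK : IsNthSyzygy n X K) (hL : IsNthSyzygy n Z L) :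
    ∃ (J : C) (a : K ⟶ J) (b : J ⟶ L), IsNthSyzygy n Y J ∧ IsShortExact a b := by
  induction n generalizing K L with
  | zero =>
    obtain ⟨⟨eK⟩, ⟨eL⟩⟩ := hK, hL
    exact ⟨Y, _, _, ⟨Iso.refl Y⟩, h.comp_iso eK eL⟩
  | succ n ih =>
    obtain ⟨⟨K', hK', hK⟩, ⟨L', hL', hL⟩⟩ := hK, hL
    obtain ⟨J', a', b', hJ', hab'⟩ := ih hK' hL'
    obtain ⟨J, a, b, hJ, hab⟩ := IsFirstSyzygy.exists_horseshoe hab' hK hL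
    exact ⟨J, a, b, ⟨J', hJ', hJ⟩, hab⟩

theorem IsFirstSyzygy.hasProjectiveDimensionLE_succ_iff {M K : C} (h : IsFirstSyzygy M K) {n : ℕ} :
    HasProjectiveDimensionLE M (n + 1) ↔ HasProjectiveDimensionLE K n := by
  obtain ⟨P, f, g, hP, hfg⟩ := h
  exact hfg.2.hasProjectiveDimensionLT_X₃_iff n hP

theorem IsFirstSyzygy.projective {M K : C} (h : IsFirstSyzygy M K) [hM : Projective M] :
    Projective K := by
  rw [projective_iff_hasProjectiveDimensionLE_zero] at hM ⊢
  exact h.hasProjectiveDimensionLE_succ_iff.1 inferInstance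

theorem IsNthSyzygy.projective_iff {M K : C} {n : ℕ} (h : IsNthSyzygy n M K) :
    Projective K ↔ HasProjectiveDimensionLE M n := by
  induction n generalizing M with
  | zero =>
    obtain ⟨e⟩ := h
    rw [← projective_iff_hasProjectiveDimensionLE_zero]
    exact ⟨Projective.of_iso e.symm, Projective.of_iso e⟩
  | succ n ih =>
    obtain ⟨L, hL, hK⟩ := h.exists_isFirstSyzygy
    rw [ih hK, hL.hasProjectiveDimensionLE_succ_iff]

variable [HasExt.{w} C]

open Abelian

theorem IsFirstSyzygy.subsingleton_ext_iff {M K : C} (h : IsFirstSyzygy M K) {T : C} {i : ℕ}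
    (hi : 1 ≤ i) : Subsingleton (Ext M T (i + 1)) ↔ Subsingleton (Ext K T i) := by
  obtain ⟨P, f, g, hP, hfg⟩ := h
  exact subsingleton_ext_shift_left hfg hi

theorem IsNthSyzygy.subsingleton_ext_iff {M K : C} {n : ℕ} (h : IsNthSyzygy n M K) {T : C} {i : ℕ}
    (hi : 1 ≤ i) : Subsingleton (Ext M T (i + n)) ↔ Subsingleton (Ext K T i) := by
  induction n generalizing M with
  | zero =>
    obtain ⟨e⟩ := h
    exact ⟨subsingleton_ext_of_retract_left (.ofIso e.symm),
      subsingleton_ext_of_retract_left (.ofIso e)⟩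
  | succ n ih =>
    obtain ⟨L, hL, hK⟩ := h.exists_isFirstSyzygy
    rw [← add_assoc, hL.subsingleton_ext_iff (by omega), ih hK]

theorem IsFirstSyzygy.projective_of_subsingleton_ext {M K : C} (h : IsFirstSyzygy M K)
    (hMK : Subsingleton (Ext M K 1)) : Projective M := by
  obtain ⟨P, f, g, hP, hfg⟩ := h
  obtain ⟨s, hs⟩ := exists_lift_of_subsingleton_ext hfg hMK (𝟙 M)
  exact Retract.projective ⟨s, g, hs⟩

end Syzygy

theorem exists_int_seq {α : Type*} {r : α → α → Prop} {p q : α → Prop} (hpq : ∀ a, p a → q a)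
    (forward : ∀ a, p a → ∃ b, p b ∧ r a b) (backward : ∀ a, q a → ∃ b, q b ∧ r b a) {a : α}
    (ha : p a) : ∃ G : ℤ → α, G 0 = a ∧ (∀ n, q (G n)) ∧ ∀ n, r (G n) (G (n + 1)) := by
  choose! f hf hfr using forward
  choose! b hb hbr using backward
  have hpf (n : ℕ) : p (f^[n] a) :=
    Function.Iterate.rec p ha hf n
  have hqb (n : ℕ) : q (b^[n] a) :=
    Function.Iterate.rec q (hpq a ha) hb n
  refine ⟨fun | .ofNat n => f^[n] a | .negSucc n => b^[n + 1] a, rfl, ?_, ?_⟩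
  · rintro (n | n)
    exacts [hpq _ (hpf n), hqb (n + 1)]
  · rintro (n | _ | n)
    · change r (f^[n] a) (f^[n + 1] a)
      exact Function.iterate_succ_apply' f n a ▸ hfr _ (hpf n)
    · exact hbr a (hpq a ha)
    · change r (b^[n + 1 + 1] a) (b^[n + 1] a)
      exact Function.iterate_succ_apply' b (n + 1) a ▸ hbr _ (hqb (n + 1))

section GorensteinProjective

variable {C : Type u} [Category.{v} C] [Abelian C] [HasExt.{w} C]

open Abelian

variable (C) in
/-- The objects `M` with `Ext^i(M, Q) = 0` for all `i ≥ 1` and all projective `Q`. -/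
def projPerp : ObjectProperty C := fun M =>
  ∀ Q : C, Projective Q → ∀ i : ℕ, 1 ≤ i → Subsingleton (Ext M Q i)

variable (C) in
/-- The Gorenstein-projective objects. A totally acyclic complex is encoded by the sequence `G` of
its cocycles: the complex is acyclic with projective terms since `G n` is a first syzygy of
`G (n + 1)`, and it stays acyclic under `Hom(-, Q)` since all `G n` lie in `projPerp C`. -/
def gorensteinProjective : ObjectProperty C := fun M =>
  ∃ G : ℤ → C, Nonempty (G 0 ≅ M) ∧ (∀ n, projPerp C (G n)) ∧
    ∀ n, IsFirstSyzygy (G (n + 1)) (G n)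

theorem projPerp_of_projective {M : C} [Projective M] : projPerp C M :=
  fun Q _ _ hi => subsingleton_ext_of_projective M Q hi

theorem projPerp.of_isFirstSyzygy {M K : C} (hM : projPerp C M) (h : IsFirstSyzygy M K) :
    projPerp C K :=
  fun Q hQ i hi => (h.subsingleton_ext_iff hi).1 (hM Q hQ (i + 1) i.succ_pos)

theorem projPerp_middle {X Y Z : C} {f : X ⟶ Y} {g : Y ⟶ Z} (h : IsShortExact f g)
    (hX : projPerp C X) (hZ : projPerp C Z) : projPerp C Y :=
  fun Q hQ i hi => subsingleton_ext_from_middle h (hX Q hQ i hi) (hZ Q hQ i hi)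

theorem projPerp.of_retract {M N : C} (r : Retract M N) (hN : projPerp C N) : projPerp C M :=
  fun Q hQ i hi => subsingleton_ext_of_retract_left r (hN Q hQ i hi)

theorem gorensteinProjective.projPerp {M : C} (h : gorensteinProjective C M) : projPerp C M := by
  obtain ⟨G, ⟨e⟩, hG, -⟩ := h
  exact .of_retract (.ofIso e.symm) (hG 0)

theorem gorensteinProjective.exists_isFirstSyzygy {M : C} (h : gorensteinProjective C M) :
    ∃ N, gorensteinProjective C N ∧ IsFirstSyzygy N M := by
  obtain ⟨G, ⟨e⟩, hG, hsyz⟩ := h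
  exact ⟨G 1, ⟨fun n => G (n + 1), ⟨Iso.refl _⟩, fun n => hG (n + 1), fun n => hsyz (n + 1)⟩,
    (hsyz 0).of_iso (Iso.refl _) e⟩

theorem gorensteinProjective.exists_isNthSyzygy {M : C} (h : gorensteinProjective C M) (n : ℕ) :
    ∃ N, gorensteinProjective C N ∧ IsNthSyzygy n N M := by
  induction n with
  | zero => exact ⟨M, h, ⟨Iso.refl M⟩⟩
  | succ n ih =>
    obtain ⟨L, hL, hLM⟩ := ih
    obtain ⟨N, hN, hNL⟩ := hL.exists_isFirstSyzygy
    exact ⟨N, hN, .succ_of_isFirstSyzygy hNL hLM⟩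

variable [EnoughProjectives C]

/-- Coinduction: backwards, a totally acyclic complex can be continued by any projective
resolution, because `projPerp C` is closed under first syzygies. -/
theorem le_gorensteinProjective {p : ObjectProperty C} (hp : p ≤ projPerp C)
    (exists_cosyzygy : ∀ M, p M → ∃ N, p N ∧ IsFirstSyzygy N M) : p ≤ gorensteinProjective C := by
  intro M hM
  obtain ⟨G, rfl, hG, hsyz⟩ := exists_int_seq (r := fun M N => IsFirstSyzygy N M) hp
    exists_cosyzygy (fun N hN =>
      (exists_isFirstSyzygy N).imp fun K hK => ⟨hN.of_isFirstSyzygy hK, hK⟩) hM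
  exact ⟨G, ⟨Iso.refl _⟩, hG, hsyz⟩

theorem gorensteinProjective_of_projective {M : C} [Projective M] : gorensteinProjective C M := by
  refine le_gorensteinProjective (p := isProjective C) (fun M hM => ?_) (fun M hM => ?_) M ‹_›
  · have : Projective M := hM
    exact projPerp_of_projective
  · exact ⟨cokernel (𝟙 M), (isZero_cokernel_of_epi (𝟙 M)).projective, M, 𝟙 M, _, hM,
      isShortExact_cokernel_π (𝟙 M)⟩

theorem gorensteinProjective.of_isFirstSyzygy {M K : C} (hM : gorensteinProjective C M)
    (h : IsFirstSyzygy M K) : gorensteinProjective C K := by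
  refine le_gorensteinProjective
    (p := fun K => ∃ M, gorensteinProjective C M ∧ IsFirstSyzygy M K) ?_ ?_ K ⟨M, hM, h⟩
  · rintro K ⟨M, hM, hK⟩
    exact hM.projPerp.of_isFirstSyzygy hK
  · rintro K ⟨M, hM, hK⟩
    exact ⟨M, hM.exists_isFirstSyzygy, hK⟩

end GorensteinProjective

section Extensions

variable {C : Type u} [Category.{v} C] [Abelian C] [HasExt.{w} C]

open Abelian

theorem exists_cosyzygy_horseshoe {X Y Z X' Z' : C} {f : X ⟶ Y} {g : Y ⟶ Z}
    (h : IsShortExact f g) (hZ : projPerp C Z) (hX' : IsFirstSyzygy X' X)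
    (hZ' : IsFirstSyzygy Z' Z) :
    ∃ (Y' : C) (a : X' ⟶ Y') (b : Y' ⟶ Z'), IsFirstSyzygy Y' Y ∧ IsShortExact a b := by
  obtain ⟨P, k, p, hP, hkp⟩ := hX'
  obtain ⟨Q, l, q, hQ, hlq⟩ := hZ'
  obtain ⟨t, rfl⟩ := exists_extension_of_subsingleton_ext h (hZ P hP 1 le_rfl) k
  obtain ⟨J, a, b, c, d, hab, hcd⟩ :=
    h.op.exists_horseshoe (s := t.op) hlq.op (by simpa only [op_comp] using hkp.op)
  exact ⟨J.unop, b.unop, a.unop, ⟨_, d.unop, c.unop, inferInstance, hcd.unop⟩, hab.unop⟩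

theorem projPerp.subsingleton_ext_iff {G : C} (hG : projPerp C G) {n : ℕ} {M K : C}
    (hK : IsNthSyzygy n M K) {i : ℕ} (hi : 1 ≤ i) :
    Subsingleton (Ext G K (i + n)) ↔ Subsingleton (Ext G M i) := by
  induction n generalizing M i with
  | zero =>
    obtain ⟨e⟩ := hK
    exact ⟨subsingleton_ext_of_retract_right (.ofIso e),
      subsingleton_ext_of_retract_right (.ofIso e.symm)⟩
  | succ n ih =>
    obtain ⟨L, ⟨P, f, g, hP, hfg⟩, hK⟩ := hK.exists_isFirstSyzygy
    rw [← add_assoc, add_right_comm, ih hK (by omega)]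
    exact ⟨fun hL => subsingleton_ext_to_right hfg hL (hG P hP i hi),
      fun hM => subsingleton_ext_to_left hfg (hG P hP _ i.succ_pos) hM⟩

variable [EnoughProjectives C]

theorem gorensteinProjective_middle {X Y Z : C} {f : X ⟶ Y} {g : Y ⟶ Z} (h : IsShortExact f g)
    (hX : gorensteinProjective C X) (hZ : gorensteinProjective C Z) :
    gorensteinProjective C Y := by
  refine le_gorensteinProjective (p := fun Y => ∃ (X Z : C) (f : X ⟶ Y) (g : Y ⟶ Z),
    IsShortExact f g ∧ gorensteinProjective C X ∧ gorensteinProjective C Z) ?_ ?_ Y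
    ⟨X, Z, f, g, h, hX, hZ⟩
  · rintro Y ⟨X, Z, f, g, h, hX, hZ⟩
    exact projPerp_middle h hX.projPerp hZ.projPerp
  · rintro Y ⟨X, Z, f, g, h, hX, hZ⟩
    obtain ⟨X', hX', hX'X⟩ := hX.exists_isFirstSyzygy
    obtain ⟨Z', hZ', hZ'Z⟩ := hZ.exists_isFirstSyzygy
    obtain ⟨Y', a, b, hY'Y, hab⟩ := exists_cosyzygy_horseshoe h hZ.projPerp hX'X hZ'Z
    exact ⟨Y', ⟨X', Z', a, b, hab, hX', hZ'⟩, hY'Y⟩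

theorem IsFirstSyzygy.exists_gorensteinProjective_cover {M L Z G : C} (hL : IsFirstSyzygy M L)
    {a : L ⟶ Z} {b : Z ⟶ G} (hab : IsShortExact a b) (hG : gorensteinProjective C G) :
    ∃ (W : C) (i : Z ⟶ W) (q : W ⟶ M), IsShortExact i q ∧ gorensteinProjective C W := by
  obtain ⟨P, f, g, hP, hfg⟩ := hL
  have sq := IsPushout.of_hasPushout f a
  obtain ⟨q, hq⟩ := hfg.exists_of_isPushout sq
  obtain ⟨r, hr⟩ := hab.exists_of_isPushout sq.flip
  exact ⟨_, _, q, hq, gorensteinProjective_middle hr gorensteinProjective_of_projective hG⟩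

/-- The middle term `V` of the new embedding is the pushout of `Z ⟵ W ⟶ M` along an embedding of
the Gorenstein-projective object `W` into a projective object. -/
theorem IsNthSyzygy.exists_gorensteinProjective_embedding {n : ℕ} {M K : C}
    (hK : IsNthSyzygy n M K) (hGP : gorensteinProjective C K) :
    ∃ (V G : C) (a : M ⟶ V) (b : V ⟶ G),
      IsShortExact a b ∧ HasProjectiveDimensionLE V n ∧ gorensteinProjective C G := by
  induction n generalizing M with
  | zero =>
    obtain ⟨e⟩ := hK
    obtain ⟨G, hG, P, f, g, hP, hfg⟩ := hGP.exists_isFirstSyzygy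
    exact ⟨P, G, _, _, hfg.comp_iso e.symm (Iso.refl G),
      (projective_iff_hasProjectiveDimensionLE_zero _).1 hP, hG⟩
  | succ n ih =>
    obtain ⟨L, hL, hLK⟩ := hK.exists_isFirstSyzygy
    obtain ⟨Z, G, a, b, hab, hZ, hG⟩ := ih hLK
    obtain ⟨W, i, q, hiq, hW⟩ := hL.exists_gorensteinProjective_cover hab hG
    obtain ⟨G', hG', P, f, g, hP, hfg⟩ := hW.exists_isFirstSyzygy
    obtain ⟨V, c, d, e, hcd, he⟩ := hiq.op.exists_preimage hfg.op
    have hVZ : IsFirstSyzygy V.unop Z := ⟨P, _, e.unop, hP, he.unop⟩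
    exact ⟨V.unop, G', d.unop, c.unop, hcd.unop, hVZ.hasProjectiveDimensionLE_succ_iff.2 hZ, hG'⟩

theorem projPerp.subsingleton_ext {G M : C} (hG : projPerp C G) {n : ℕ}
    (hM : HasProjectiveDimensionLE M n) {i : ℕ} (hi : 1 ≤ i) : Subsingleton (Ext G M i) := by
  obtain ⟨K, hK⟩ := exists_isNthSyzygy n M
  exact (hG.subsingleton_ext_iff hK hi).1 (hG K (hK.projective_iff.2 hM) _ (by omega))

theorem projPerp.projective {M : C} (h : projPerp C M) {n : ℕ} (hM : HasProjectiveDimensionLE M n) :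
    Projective M := by
  obtain ⟨K, hK⟩ := exists_isFirstSyzygy M
  have hKn : HasProjectiveDimensionLE K n :=
    hK.hasProjectiveDimensionLE_succ_iff.1 (hasProjectiveDimensionLT_of_ge M (n + 1) _ (by omega))
  exact hK.projective_of_subsingleton_ext (h.subsingleton_ext hKn le_rfl)

end Extensions

section CotorsionPair

variable {C : Type u} [Category.{v} C] [Abelian C]

open Abelian ZeroObject

theorem isClosedUnderFiniteProducts_of_isClosedUnderExtensions (P : ObjectProperty C)
    [P.IsStableUnderRetracts] [P.ContainsZero] [P.IsClosedUnderExtensions] :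
    P.IsClosedUnderFiniteProducts := by
  have : P.IsClosedUnderBinaryProducts := ⟨by
    rintro X ⟨p⟩
    refine P.prop_of_iso ?_ (P.prop_biprod (p.prop_diag_obj (.mk .left))
      (p.prop_diag_obj (.mk .right)))
    exact IsLimit.conePointUniqueUpToIso (BinaryBiproduct.isLimit _ _)
      ((IsLimit.postcomposeHomEquiv (diagramIsoPair p.diag) _).2 p.isLimit)⟩
  exact .mk'

variable [HasExt.{w} C]

theorem IsCotorsionPair.of_approx {F G : ObjectProperty C} [F.IsStableUnderRetracts]
    [G.IsStableUnderRetracts] (hExt : ∀ X Y, F X → G Y → Subsingleton (Ext X Y 1))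
    (left : ∀ M, ∃ (Y X : C) (f : Y ⟶ X) (g : X ⟶ M), IsShortExact f g ∧ G Y ∧ F X)
    (right : ∀ M, ∃ (Y X : C) (f : M ⟶ Y) (g : Y ⟶ X), IsShortExact f g ∧ G Y ∧ F X) :
    IsCotorsionPair F G := by
  obtain ⟨Y, X, -, -, -, hY, hX⟩ := left (0 : C)
  have : F.Nonempty := ⟨X, hX⟩
  have : G.Nonempty := ⟨Y, hY⟩
  have : F.IsClosedUnderExtensions := ⟨fun {S} hS h₁ h₃ => by
    obtain ⟨Y, X, f, g, hfg, hY, hX⟩ := left S.X₂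
    obtain ⟨s, hs⟩ := exists_lift_of_subsingleton_ext hfg (subsingleton_ext_from_middle
      (isShortExact_of_shortExact hS) (hExt _ Y h₁ hY) (hExt _ Y h₃ hY)) (𝟙 S.X₂)
    exact F.prop_of_retract ⟨s, g, hs⟩ hX⟩
  have : G.IsClosedUnderExtensions := ⟨fun {S} hS h₁ h₃ => by
    obtain ⟨Y, X, f, g, hfg, hY, hX⟩ := right S.X₂
    obtain ⟨r, hr⟩ := exists_extension_of_subsingleton_ext hfg (subsingleton_ext_to_middle
      (isShortExact_of_shortExact hS) (hExt X _ hX h₁) (hExt X _ hX h₃)) (𝟙 S.X₂)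
    exact G.prop_of_retract ⟨f, r, hr⟩ hY⟩
  exact {
    left_additive := isClosedUnderFiniteProducts_of_isClosedUnderExtensions F
    right_additive := isClosedUnderFiniteProducts_of_isClosedUnderExtensions G
    left_summand := ‹_›
    right_summand := ‹_›
    ext_eq_zero := hExt
    left_approx M := by
      obtain ⟨Y, X, f, g, hfg, hY, hX⟩ := left M
      exact ⟨_, hfg.2, hY, hX, ⟨Iso.refl M⟩⟩
    right_approx M := by
      obtain ⟨Y, X, f, g, hfg, hY, hX⟩ := right M
      exact ⟨_, hfg.2, ⟨Iso.refl M⟩, hY, hX⟩ }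

/-- The two approximations and the two classes exchange their roles in the opposite category. -/
theorem IsCotorsionPair.of_op [EnoughProjectives C] [HasExt.{w'} Cᵒᵖ] {F G : ObjectProperty Cᵒᵖ}
    (h : IsCotorsionPair F G) : IsCotorsionPair (fun X : C => G (op X)) (fun X => F (op X)) := by
  have := h.left_summand
  have := h.right_summand
  have : ObjectProperty.IsStableUnderRetracts fun X : C => G (op X) :=
    ⟨fun r hY => G.prop_of_retract r.op hY⟩
  have : ObjectProperty.IsStableUnderRetracts fun X : C => F (op X) :=
    ⟨fun r hY => F.prop_of_retract r.op hY⟩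
  refine .of_approx (fun X Y hX hY => (subsingleton_ext_op_iff 1).1 (h.ext_eq_zero _ _ hY hX))
    (fun M => ?_) (fun M => ?_)
  · obtain ⟨S, hS, ⟨e⟩, hY, hX⟩ := h.right_approx (op M)
    exact ⟨_, _, _, _, ((isShortExact_of_shortExact hS).comp_iso e (Iso.refl _)).unop, hX, hY⟩
  · obtain ⟨S, hS, hX, hY, ⟨e⟩⟩ := h.left_approx (op M)
    exact ⟨_, _, _, _, ((isShortExact_of_shortExact hS).comp_iso (Iso.refl _) e).unop, hY, hX⟩

end CotorsionPair

section GorensteinCategory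

variable {C : Type u} [Category.{v} C] [Abelian C]

variable (C) in
/-- The two finiteness conditions on an abelian category that characterise the module categories of
`d`-Gorenstein algebras; they are exchanged by passing to the opposite category. -/
structure IsGorensteinCategory (d : ℕ) : Prop where
  hasInjectiveDimensionLE (P : C) : Projective P → HasInjectiveDimensionLE P d
  hasProjectiveDimensionLE (I : C) : Injective I → HasProjectiveDimensionLE I d

variable {d : ℕ}

theorem IsGorensteinCategory.op [EnoughProjectives C] (h : IsGorensteinCategory C d) :
    IsGorensteinCategory Cᵒᵖ d where
  hasInjectiveDimensionLE P _ :=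
    hasInjectiveDimensionLE_op_iff.2 (h.hasProjectiveDimensionLE P.unop inferInstance)
  hasProjectiveDimensionLE I _ :=
    hasProjectiveDimensionLE_op_iff.2 (h.hasInjectiveDimensionLE I.unop inferInstance)

theorem IsGorensteinCategory.of_op [EnoughProjectives C] (h : IsGorensteinCategory Cᵒᵖ d) :
    IsGorensteinCategory C d where
  hasInjectiveDimensionLE P _ :=
    hasProjectiveDimensionLE_op_iff.1 (h.hasProjectiveDimensionLE (.op P) inferInstance)
  hasProjectiveDimensionLE I _ :=
    hasInjectiveDimensionLE_op_iff.1 (h.hasInjectiveDimensionLE (.op I) inferInstance)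

variable [HasExt.{w} C] [EnoughProjectives C]

open Abelian

/-- If `0 ⟶ M ⟶ I ⟶ N ⟶ 0` is exact with `I` injective, then the horseshoe lemma makes a `d`-th
syzygy of `M` a first syzygy, up to a projective object, of a `d`-th syzygy of `N`. -/
theorem IsGorensteinCategory.gorensteinProjective_of_isNthSyzygy [EnoughInjectives C]
    (h : IsGorensteinCategory C d) {M K : C} (hK : IsNthSyzygy d M K) :
    gorensteinProjective C K := by
  refine le_gorensteinProjective (p := fun K => ∃ M, IsNthSyzygy d M K) ?_ ?_ K ⟨M, hK⟩
  · rintro K ⟨M, hK⟩ Q hQ i hi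
    have := h.hasInjectiveDimensionLE Q hQ
    exact (hK.subsingleton_ext_iff hi).1
      (hasInjectiveDimensionLE_iff_subsingleton_ext.1 this M (i + d) (by omega))
  · rintro K ⟨M, hK⟩
    have hM := isShortExact_cokernel_π (Injective.ι M)
    obtain ⟨L, hL⟩ := exists_isNthSyzygy d (cokernel (Injective.ι M))
    obtain ⟨P, a, b, hP, hab⟩ := hK.exists_horseshoe hM hL
    exact ⟨L, ⟨_, hL⟩, P, a, b, hP.projective_iff.2 (h.hasProjectiveDimensionLE _ inferInstance),
      hab⟩

/-- For `I` injective with `d`-th syzygy `K`, write `K` as a first syzygy of a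
Gorenstein-projective `Y`, and `Y` as a `d`-th syzygy of `M`: then
`Ext¹(Y, K) = Ext^{d+1}(M, K) = Ext¹(M, I) = 0`, so that `K` is projective. -/
theorem isGorensteinCategory_of_gorensteinProjective_of_isNthSyzygy
    (h : ∀ M K : C, IsNthSyzygy d M K → gorensteinProjective C K) : IsGorensteinCategory C d where
  hasInjectiveDimensionLE Q hQ := by
    refine hasInjectiveDimensionLE_iff_subsingleton_ext.2 fun T i hi => ?_
    obtain ⟨j, rfl⟩ := Nat.exists_eq_add_of_lt hi
    obtain ⟨K, hK⟩ := exists_isNthSyzygy d T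
    rw [show d + j + 1 = j + 1 + d by omega, hK.subsingleton_ext_iff j.succ_pos]
    exact (h T K hK).projPerp Q hQ _ j.succ_pos
  hasProjectiveDimensionLE I hI := by
    obtain ⟨K, hK⟩ := exists_isNthSyzygy d I
    obtain ⟨Y, hY, hYK⟩ := (h I K hK).exists_isFirstSyzygy
    obtain ⟨M, hM, hMY⟩ := hY.exists_isNthSyzygy d
    have hExt : Subsingleton (Ext Y K 1) :=
      (hMY.subsingleton_ext_iff le_rfl).1 ((hM.projPerp.subsingleton_ext_iff hK le_rfl).2
        (subsingleton_ext_of_injective M I le_rfl))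
    have := hYK.projective_of_subsingleton_ext hExt
    exact hK.projective_iff.1 hYK.projective

theorem gorensteinProjective_eq_isNthSyzygy_iff [EnoughInjectives C] :
    (gorensteinProjective C = fun K => ∃ M, IsNthSyzygy d M K) ↔ IsGorensteinCategory C d := by
  refine ⟨fun h => isGorensteinCategory_of_gorensteinProjective_of_isNthSyzygy
    fun M K hK => h ▸ ⟨M, hK⟩, fun h => funext fun K => propext ⟨fun hK => ?_, ?_⟩⟩
  · exact (hK.exists_isNthSyzygy d).imp fun _ => And.right
  · rintro ⟨M, hK⟩
    exact h.gorensteinProjective_of_isNthSyzygy hK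

variable [EnoughInjectives C] (h : IsGorensteinCategory C d)

include h

theorem IsGorensteinCategory.gorensteinProjective_eq_projPerp :
    gorensteinProjective C = projPerp C := by
  refine le_antisymm (fun M hM => hM.projPerp) fun M hM => ?_
  obtain ⟨K, hK⟩ := exists_isNthSyzygy d M
  obtain ⟨V, G, a, b, hab, hV, hG⟩ :=
    hK.exists_gorensteinProjective_embedding (h.gorensteinProjective_of_isNthSyzygy hK)
  exact hG.of_isFirstSyzygy
    ⟨V, a, b, (projPerp_middle hab hM hG.projPerp).projective hV, hab⟩

theorem IsGorensteinCategory.isCotorsionPair :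
    IsCotorsionPair (gorensteinProjective C) (fun M => HasProjectiveDimensionLE M d) := by
  have embedding (M : C) : ∃ (V G : C) (a : M ⟶ V) (b : V ⟶ G),
      IsShortExact a b ∧ HasProjectiveDimensionLE V d ∧ gorensteinProjective C G := by
    obtain ⟨K, hK⟩ := exists_isNthSyzygy d M
    exact hK.exists_gorensteinProjective_embedding (h.gorensteinProjective_of_isNthSyzygy hK)
  have : (gorensteinProjective C).IsStableUnderRetracts := by
    rw [h.gorensteinProjective_eq_projPerp]
    exact ⟨.of_retract⟩
  have : ObjectProperty.IsStableUnderRetracts fun M : C => HasProjectiveDimensionLE M d :=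
    ⟨fun r hM => r.hasProjectiveDimensionLT _⟩
  refine .of_approx (fun X Y hX hY => hX.projPerp.subsingleton_ext hY le_rfl) (fun M => ?_)
    embedding
  obtain ⟨L, hL⟩ := exists_isFirstSyzygy M
  obtain ⟨Z, G, a, b, hab, hZ, hG⟩ := embedding L
  obtain ⟨W, i, q, hiq, hW⟩ := hL.exists_gorensteinProjective_cover hab hG
  exact ⟨Z, W, i, q, hiq, hZ, hW⟩

end GorensteinCategory

section Splice

variable {C : Type u} [Category.{v} C] [Abelian C]

theorem isShortExact_cycles {P : CochainComplex C ℤ} (hP : P.Acyclic) (n : ℤ) :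
    IsShortExact (P.iCycles n) (P.toCycles n (n + 1)) := by
  have : Epi (P.toCycles n (n + 1)) := by
    rw [epi_iff_surjective_up_to_refinements]
    intro T t
    obtain ⟨T', π, hπ, s, hs⟩ :=
      (P.exactAt_iff_exact_up_to_refinements n (n + 1) (n + 1 + 1) (by simp) (by simp)).1
        (hP (n + 1)) (t ≫ P.iCycles (n + 1)) (by simp)
    exact ⟨T', π, hπ, s, by simpa [← cancel_mono (P.iCycles (n + 1))] using hs⟩
  refine .of_exists_lift (by simp [← cancel_mono (P.iCycles (n + 1))]) fun T t ht => ?_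
  exact ⟨P.liftCycles t (n + 1) (by simp) (by rw [← P.toCycles_i, reassoc_of% ht, zero_comp]),
    P.liftCycles_i ..⟩

section

variable {P : CochainComplex C ℤ} {G : ℤ → C} {f : ∀ n, G n ⟶ P.X n} {g : ∀ n, P.X n ⟶ G (n + 1)}
  (h : ∀ n, IsShortExact (f n) (g n)) (hd : ∀ n, P.d n (n + 1) = g n ≫ f (n + 1))

include h hd

theorem nonempty_iso_cycles (n : ℤ) : Nonempty (G n ≅ P.cycles n) := by
  have := (h n).mono
  have := (h (n + 1)).mono
  have hker : IsLimit (KernelFork.ofι (f := P.d n (n + 1)) (f n)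
      (by rw [hd, reassoc_of% (h n).zero, zero_comp])) :=
    KernelFork.IsLimit.ofι' _ _ fun {T} t ht =>
      have ht : t ≫ g n = 0 := by simpa [hd, ← cancel_mono (f (n + 1))] using ht
      ⟨(h n).2.exact.lift t ht, (h n).2.exact.lift_f t ht⟩
  exact ⟨hker.conePointUniqueUpToIso (P.cyclesIsKernel n (n + 1) (by simp))⟩

theorem acyclic_of_isShortExact : P.Acyclic := by
  intro m
  obtain ⟨n, rfl⟩ : ∃ n, m = n + 1 := ⟨m - 1, by ring⟩
  have := (h n).epi
  have := (h (n + 1 + 1)).mono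
  rw [P.exactAt_iff_exact_up_to_refinements n (n + 1) (n + 1 + 1) (by simp) (by simp)]
  intro T t ht
  obtain ⟨T', π, hπ, s, hs⟩ := (h (n + 1)).exists_lift_up_to_refinements (g n) t
    (by simpa [hd, ← cancel_mono (f (n + 1 + 1))] using ht)
  exact ⟨T', π, hπ, s, by rw [hs, hd]⟩

end

/-- The complex with terms `X n` obtained by splicing exact sequences
`0 ⟶ G n ⟶ X n ⟶ G (n + 1) ⟶ 0`. -/
abbrev spliceComplex {G X : ℤ → C} {f : ∀ n, G n ⟶ X n} {g : ∀ n, X n ⟶ G (n + 1)}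
    (h : ∀ n, IsShortExact (f n) (g n)) : CochainComplex C ℤ :=
  CochainComplex.of X (fun n => g n ≫ f (n + 1)) fun n => by
    rw [Category.assoc, reassoc_of% (h (n + 1)).zero, zero_comp, comp_zero]

end Splice

section ExtOne

variable {C : Type u} [Category.{v} C] [Abelian C] [HasExt.{w} C]
  {G₁ G₂ G₃ X₁ X₂ : C} {f₁ : G₁ ⟶ X₁} {g₁ : X₁ ⟶ G₂} {f₂ : G₂ ⟶ X₂} {g₂ : X₂ ⟶ G₃}
  (h₁ : IsShortExact f₁ g₁) (h₂ : IsShortExact f₂ g₂)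

open Abelian

include h₁ h₂

theorem subsingleton_ext_one_iff_exists_comp_eq [Projective X₂] {X₀ Q : C} (p : X₀ ⟶ G₁) [Epi p] :
    Subsingleton (Ext G₃ Q 1) ↔
      ∀ φ : X₁ ⟶ Q, (p ≫ f₁) ≫ φ = 0 → ∃ ψ : X₂ ⟶ Q, (g₁ ≫ f₂) ≫ ψ = φ := by
  have := h₁.epi
  rw [subsingleton_ext_one_iff_exists_extension h₂]
  refine ⟨fun hext φ hφ => ?_, fun hext φ => ?_⟩
  · obtain ⟨φ, rfl⟩ := h₁.exists_desc φ (by simpa [← cancel_epi p] using hφ)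
    exact (hext φ).imp fun ψ hψ => by simp [hψ]
  · exact (hext (g₁ ≫ φ) (by simp [reassoc_of% h₁.zero])).imp fun ψ hψ => by
      simpa [← cancel_epi g₁] using hψ

theorem subsingleton_ext_one_iff_exists_eq_comp [Injective X₁] {X₃ J : C} (i : G₃ ⟶ X₃) [Mono i] :
    Subsingleton (Ext J G₁ 1) ↔
      ∀ φ : J ⟶ X₂, φ ≫ g₂ ≫ i = 0 → ∃ ψ : J ⟶ X₁, ψ ≫ g₁ ≫ f₂ = φ := by
  have := h₂.mono
  rw [subsingleton_ext_one_iff_exists_lift h₁]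
  refine ⟨fun hlift φ hφ => ?_, fun hlift φ => ?_⟩
  · obtain ⟨φ, rfl⟩ := h₂.exists_lift φ (by simpa [← cancel_mono i] using hφ)
    exact (hlift φ).imp fun ψ hψ => by simp [reassoc_of% hψ]
  · exact (hlift (φ ≫ f₂) (by simp [reassoc_of% h₂.zero])).imp fun ψ hψ => by
      simpa [← cancel_mono f₂] using hψ

end ExtOne

theorem projPerp_of_forall_subsingleton_ext_one {C : Type u} [Category.{v} C] [Abelian C]
    [HasExt.{w} C] {G : ℤ → C} (hG : ∀ n, IsFirstSyzygy (G (n + 1)) (G n))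
    (h : ∀ Q : C, Projective Q → ∀ n, Subsingleton (Abelian.Ext (G n) Q 1)) (n : ℤ) :
    projPerp C (G n) := by
  intro Q hQ i hi
  induction i, hi using Nat.le_induction generalizing n with
  | base => exact h Q hQ n
  | succ i hi ih =>
    obtain ⟨m, rfl⟩ : ∃ m, n = m + 1 := ⟨n - 1, by ring⟩
    exact ((hG m).subsingleton_ext_iff hi).2 (ih m)

section Modules

variable {A : Type u} [Ring A] {M K : ModuleCat.{u} A}

theorem isSyzygy_iff {d : ℕ} : IsSyzygy d M K ↔ IsNthSyzygy d M K := by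
  induction d generalizing K with
  | zero => rfl
  | succ d ih =>
    constructor
    · rintro ⟨S, hS, hP, ⟨e⟩, h⟩
      exact ⟨S.X₃, ih.1 h, S.X₂, _, _, hP,
        (isShortExact_of_shortExact hS).comp_iso e (Iso.refl _)⟩
    · rintro ⟨L, hL, P, f, g, hP, hfg⟩
      exact ⟨_, hfg.2, hP, ⟨Iso.refl K⟩, ih.2 hL⟩

theorem isCosyzygy_iff {d : ℕ} : IsCosyzygy d M K ↔ IsNthSyzygy d (op M) (op K) := by
  induction d generalizing K with
  | zero => exact ⟨fun ⟨e⟩ => ⟨e.symm.op⟩, fun ⟨e⟩ => ⟨e.symm.unop⟩⟩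
  | succ d ih =>
    constructor
    · rintro ⟨S, hS, hI, ⟨e⟩, h⟩
      exact ⟨op S.X₁, ih.1 h, op S.X₂, _, _, inferInstance,
        ((isShortExact_of_shortExact hS).comp_iso (Iso.refl _) e).op⟩
    · rintro ⟨L, hL, P, f, g, hP, hfg⟩
      exact ⟨_, hfg.unop.2, inferInstanceAs (Injective P.unop), ⟨Iso.refl K⟩, ih.2 hL⟩

theorem nonempty_linearEquiv_ker_iff (P : CochainComplex (ModuleCat.{u} A) ℤ) (n : ℤ) :
    Nonempty (M ≃ₗ[A] LinearMap.ker (P.d n (n + 1)).hom) ↔ Nonempty (P.cycles n ≅ M) := by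
  let e : P.cycles n ≅ ModuleCat.of A (LinearMap.ker (P.d n (n + 1)).hom) :=
    (P.cyclesIsKernel n (n + 1) (by simp)).conePointUniqueUpToIso (ModuleCat.kernelIsLimit _)
  exact ⟨fun ⟨e'⟩ => ⟨e ≪≫ e'.toModuleIso.symm⟩, fun ⟨e'⟩ => ⟨(e'.symm ≪≫ e).toLinearEquiv⟩⟩

theorem ker_eq_range_of_acyclic {P : CochainComplex (ModuleCat.{u} A) ℤ} (hP : P.Acyclic) (n : ℤ) :
    LinearMap.ker (P.d n (n + 1)).hom = LinearMap.range (P.d (n - 1) n).hom := by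
  have := (P.exactAt_iff' (n - 1) n (n + 1) (by simp) (by simp)).1 (hP n)
  exact ((ShortComplex.ShortExact.moduleCat_exact_iff_function_exact _).1 this).linearMap_ker_eq

theorem gproj_iff_gorensteinProjective : GProj A M ↔ gorensteinProjective _ M := by
  constructor
  · rintro ⟨P, hP, e⟩
    have hsyz (n : ℤ) := isShortExact_cycles hP.acyclic n
    have hP' := hP.projective
    have hG (n : ℤ) : IsFirstSyzygy (P.cycles (n + 1)) (P.cycles n) :=
      ⟨P.X n, _, _, inferInstance, hsyz n⟩
    refine ⟨fun n => P.cycles n, (nonempty_linearEquiv_ker_iff P 0).1 e,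
      projPerp_of_forall_subsingleton_ext_one hG fun Q hQ n => ?_, hG⟩
    obtain ⟨m, rfl⟩ : ∃ m, n = m + 1 + 1 + 1 := ⟨n - 3, by ring⟩
    have := (hsyz m).epi
    rw [subsingleton_ext_one_iff_exists_comp_eq (hsyz (m + 1)) (hsyz (m + 1 + 1))
      (P.toCycles m (m + 1))]
    have hexact := hP.hom_acyclic Q hQ (m + 1)
    rw [add_sub_cancel_right] at hexact
    simpa only [HomologicalComplex.toCycles_i] using hexact
  · rintro ⟨G, ⟨e⟩, hG, hsyz⟩
    choose X f g hX h using hsyz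
    have hd (n : ℤ) : (spliceComplex h).d n (n + 1) = g n ≫ f (n + 1) := by simp
    obtain ⟨e'⟩ := nonempty_iso_cycles h hd 0
    refine ⟨spliceComplex h, ⟨hX, acyclic_of_isShortExact h hd, fun Q hQ n => ?_⟩,
      (nonempty_linearEquiv_ker_iff _ 0).2 ⟨e'.symm ≪≫ e⟩⟩
    obtain ⟨m, rfl⟩ : ∃ m, n = m + 1 := ⟨n - 1, by ring⟩
    have := (h m).epi
    rw [add_sub_cancel_right]
    simpa only [CochainComplex.of_d] using
      (subsingleton_ext_one_iff_exists_comp_eq (h (m + 1)) (h (m + 1 + 1)) (g m)).1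
        (hG _ Q hQ 1 le_rfl)

/-- A cototally acyclic complex becomes totally acyclic in the opposite category after
reindexing along `n ↦ -n`. -/
theorem gorensteinProjective_op_of_ginj [HasExt.{w'} (ModuleCat.{u} A)ᵒᵖ] (hM : GInj A M) :
    gorensteinProjective (ModuleCat.{u} A)ᵒᵖ (op M) := by
  obtain ⟨I, hI, ⟨e⟩⟩ := hM
  have hsyz (n : ℤ) := isShortExact_cycles hI.acyclic n
  have hI' := hI.injective
  have hG (n : ℤ) : IsFirstSyzygy (op (I.cycles (-(n + 1)))) (op (I.cycles (-n))) := by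
    have : IsFirstSyzygy (op (I.cycles (-(n + 1)))) (op (I.cycles (-(n + 1) + 1))) :=
      ⟨op (I.X _), _, _, inferInstance, (hsyz _).op⟩
    simpa only [neg_add, neg_add_cancel_right] using this
  obtain ⟨e'⟩ := (nonempty_linearEquiv_ker_iff I 0).1
    ⟨e.trans (.ofEq _ _ (ker_eq_range_of_acyclic hI.acyclic 0).symm)⟩
  refine ⟨fun n => op (I.cycles (-n)), ⟨e'.symm.op⟩,
    projPerp_of_forall_subsingleton_ext_one hG fun Q hQ n => ?_, hG⟩
  have := (hsyz (-n + 1 + 1)).mono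
  refine (subsingleton_ext_op_iff (X := Q.unop) (T := I.cycles (-n)) 1).2
    ((subsingleton_ext_one_iff_exists_eq_comp (hsyz (-n)) (hsyz (-n + 1))
    (I.iCycles (-n + 1 + 1))).2 ?_)
  have hexact := hI.hom_acyclic Q.unop inferInstance (-n + 1)
  rw [add_sub_cancel_right] at hexact
  simpa only [HomologicalComplex.toCycles_i] using hexact

theorem ginj_of_gorensteinProjective_op [HasExt.{w'} (ModuleCat.{u} A)ᵒᵖ]
    (hM : gorensteinProjective (ModuleCat.{u} A)ᵒᵖ (op M)) : GInj A M := by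
  obtain ⟨G, ⟨e⟩, hG, hsyz⟩ := hM
  have hsyz' (n : ℤ) : IsFirstSyzygy (op (G (-n)).unop) (op (G (-(n + 1))).unop) := by
    simpa using hsyz (-(n + 1))
  choose X g f hX h using hsyz'
  have h' (n : ℤ) := (h n).unop
  have hd (n : ℤ) : (spliceComplex h').d n (n + 1) = (g n).unop ≫ (f (n + 1)).unop := by
    simp
  obtain ⟨e'⟩ := nonempty_iso_cycles (P := spliceComplex h') h' hd 0
  have hacyc := acyclic_of_isShortExact (P := spliceComplex h') h' hd
  obtain ⟨e''⟩ := (nonempty_linearEquiv_ker_iff _ 0).2 ⟨e'.symm ≪≫ e.unop.symm⟩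
  refine ⟨spliceComplex h', ⟨fun n => inferInstanceAs (Injective (X n).unop),
    hacyc, fun J hJ n => ?_⟩,
    ⟨e''.trans (.ofEq _ _ (ker_eq_range_of_acyclic hacyc 0))⟩⟩
  obtain ⟨m, rfl⟩ : ∃ m, n = m + 1 := ⟨n - 1, by ring⟩
  have := (h' (m + 1 + 1)).mono
  have hExt := (subsingleton_ext_op_iff (X := J) (T := (G (-m)).unop) 1).1
    (hG (-m) (op J) inferInstance 1 le_rfl)
  rw [add_sub_cancel_right]
  simpa only [CochainComplex.of_d] using
    (subsingleton_ext_one_iff_exists_eq_comp (h' m) (h' (m + 1)) (f (m + 1 + 1)).unop).1 hExt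

end Modules

section ExtOfCoproducts

open Abelian

variable {C : Type u} [Category.{v} C] [Abelian C] [HasExt.{w} C] {ι : Type w'}

theorem subsingleton_ext_sigma [EnoughInjectives C] (X : ι → C) [HasCoproduct X] {Y : C} {i : ℕ}
    (hi : 1 ≤ i) (h : ∀ j, Subsingleton (Ext (X j) Y i)) : Subsingleton (Ext (∐ X) Y i) := by
  have hY (Y : C) := isShortExact_cokernel_π (Injective.ι Y)
  induction i, hi using Nat.le_induction generalizing Y with
  | base =>
    refine (subsingleton_ext_one_iff_exists_lift (hY Y)).2 fun φ => ?_
    choose ψ hψ using fun j =>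
      (subsingleton_ext_one_iff_exists_lift (hY Y)).1 (h j) (Sigma.ι X j ≫ φ)
    exact ⟨Sigma.desc ψ, Sigma.hom_ext _ _ fun j => by simp [hψ]⟩
  | succ i hi ih =>
    exact (subsingleton_ext_shift_right (hY Y) hi).2 <| ih fun j =>
      (subsingleton_ext_shift_right (hY Y) hi).1 (h j)

theorem subsingleton_ext_pi [EnoughProjectives C] (Y : ι → C) [HasProduct Y] {X : C} {i : ℕ}
    (hi : 1 ≤ i) (h : ∀ j, Subsingleton (Ext X (Y j) i)) : Subsingleton (Ext X (∏ᶜ Y) i) := by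
  have hX (X : C) := isShortExact_kernel_ι (Projective.π X)
  induction i, hi using Nat.le_induction generalizing X with
  | base =>
    refine (subsingleton_ext_one_iff_exists_extension (hX X)).2 fun φ => ?_
    choose ψ hψ using fun j =>
      (subsingleton_ext_one_iff_exists_extension (hX X)).1 (h j) (φ ≫ Pi.π Y j)
    exact ⟨Pi.lift ψ, Pi.hom_ext _ _ fun j => by simp [hψ]⟩
  | succ i hi ih =>
    exact (subsingleton_ext_shift_left (hX X) hi).2 <| ih fun j =>
      (subsingleton_ext_shift_left (hX X) hi).1 (h j)

end ExtOfCoproducts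

section DimensionOfCoproducts

variable {C : Type u} [Category.{v} C] [Abelian C] {ι : Type w'}

theorem hasProjectiveDimensionLE_sigma [EnoughInjectives C] (X : ι → C) [HasCoproduct X] {n : ℕ}
    (h : ∀ j, HasProjectiveDimensionLE (X j) n) : HasProjectiveDimensionLE (∐ X) n := by
  let _ := HasExt.standard C
  exact hasProjectiveDimensionLE_iff_subsingleton_ext.2 fun T i hi =>
    subsingleton_ext_sigma X (Nat.one_le_of_lt hi) fun j =>
      hasProjectiveDimensionLE_iff_subsingleton_ext.1 (h j) T i hi

theorem hasInjectiveDimensionLE_pi [EnoughProjectives C] (Y : ι → C) [HasProduct Y] {n : ℕ}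
    (h : ∀ j, HasInjectiveDimensionLE (Y j) n) : HasInjectiveDimensionLE (∏ᶜ Y) n := by
  let _ := HasExt.standard C
  exact hasInjectiveDimensionLE_iff_subsingleton_ext.2 fun T i hi =>
    subsingleton_ext_pi Y (Nat.one_le_of_lt hi) fun j =>
      hasInjectiveDimensionLE_iff_subsingleton_ext.1 (h j) T i hi

end DimensionOfCoproducts

section Matlis

variable {R : Type u} [CommRing R]

theorem IsInjectiveHull.mem_range_of_forall_smul_eq_zero {M E : Type u} [AddCommGroup M]
    [Module R M] [AddCommGroup E] [Module R E] {ι : M →ₗ[R] E} (hι : IsInjectiveHull ι)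
    {𝔪 : Ideal R} (h𝔪 : 𝔪.IsMaximal) {x : E} (hx : ∀ r ∈ 𝔪, r • x = 0) :
    x ∈ LinearMap.range ι := by
  by_cases hx0 : x = 0
  · exact hx0 ▸ Submodule.zero_mem _
  have hne : R ∙ x ⊓ LinearMap.range ι ≠ ⊥ := fun h =>
    hx0 (Submodule.span_singleton_eq_bot.1 (hι.essential _ h))
  obtain ⟨y, ⟨hyx, hy⟩, hy0⟩ := Submodule.exists_mem_ne_zero_of_ne_bot hne
  obtain ⟨r, rfl⟩ := Submodule.mem_span_singleton.1 hyx
  obtain ⟨s, m, hm, hsm⟩ := h𝔪.exists_inv fun hr => hy0 (hx r hr)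
  have hxr : x = s • r • x := by
    rw [smul_smul, ← add_zero ((s * r) • x), ← hx m hm, ← add_smul, hsm, one_smul]
  exact hxr ▸ Submodule.smul_mem _ s hy

theorem apply_eq_zero_of_forall_smul_eq_zero {𝔪 𝔫 : MaximalSpectrum R} (hne : 𝔫 ≠ 𝔪)
    {t : SimpleSum R} (ht : ∀ r ∈ 𝔪.asIdeal, r • t = 0) : t 𝔫 = 0 := by
  have hnle : ¬ 𝔪.asIdeal ≤ 𝔫.asIdeal := fun hle =>
    hne (MaximalSpectrum.ext (𝔪.isMaximal.eq_of_le 𝔫.isMaximal.ne_top hle).symm)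
  obtain ⟨r, hr, hrn⟩ := Set.not_subset.1 hnle
  have := 𝔫.isMaximal.isPrime
  have hrt : Ideal.Quotient.mk 𝔫.asIdeal r * t 𝔫 = 0 := by
    rw [← Ideal.Quotient.algebraMap_eq, ← Algebra.smul_def, ← DirectSum.smul_apply, ht r hr,
      DirectSum.zero_apply]
  exact (mul_eq_zero.1 hrt).resolve_left fun h => hrn (Ideal.Quotient.eq_zero_iff_mem.1 h)

open Classical in
theorem exists_minInjCogeneratorι_lof_eq {𝔪 : MaximalSpectrum R} {x : minInjCogenerator R}
    (hx : ∀ r ∈ 𝔪.asIdeal, r • x = 0) : ∃ a : R ⧸ 𝔪.asIdeal,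
      minInjCogeneratorι R (DirectSum.lof R _ (fun 𝔪 => R ⧸ 𝔪.asIdeal) 𝔪 a) = x := by
  have hι := isInjectiveHull_minInjCogeneratorι R
  obtain ⟨t, rfl⟩ := hι.mem_range_of_forall_smul_eq_zero 𝔪.isMaximal hx
  have ht (r) (hr : r ∈ 𝔪.asIdeal) : r • t = 0 :=
    hι.mono (by rw [map_smul, hx r hr, map_zero])
  refine ⟨t 𝔪, congrArg _ (DFinsupp.ext fun 𝔫 => ?_)⟩
  rcases eq_or_ne 𝔫 𝔪 with rfl | hne
  · exact DirectSum.of_eq_same (β := fun 𝔪 : MaximalSpectrum R => R ⧸ 𝔪.asIdeal) _ _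
  · exact (DirectSum.of_eq_of_ne (β := fun 𝔪 : MaximalSpectrum R => R ⧸ 𝔪.asIdeal) _ _ _ hne).trans
      (apply_eq_zero_of_forall_smul_eq_zero hne ht).symm

theorem length_hom_minInjCogenerator_le_one (S : Type v) [AddCommGroup S] [Module R S]
    [IsSimpleModule R S] : Module.length R (S →ₗ[R] minInjCogenerator R) ≤ 1 := by
  classical
  have := IsSimpleModule.nontrivial R S
  obtain ⟨s, hs⟩ := exists_ne (0 : S)
  let 𝔪 : MaximalSpectrum R := ⟨_, IsSimpleModule.ker_toSpanSingleton_isMaximal R hs⟩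
  let j := minInjCogeneratorι R ∘ₗ DirectSum.lof R _ (fun 𝔪 => R ⧸ 𝔪.asIdeal) 𝔪
  let evalAt : (S →ₗ[R] minInjCogenerator R) →ₗ[R] LinearMap.range j :=
    (LinearMap.applyₗ s).codRestrict _ fun f => exists_minInjCogeneratorι_lof_eq fun r hr => by
      rw [LinearMap.applyₗ_apply_apply, ← map_smul, show r • s = 0 from hr, map_zero]
  have injective_evalAt : Function.Injective evalAt := fun f g hfg => LinearMap.ext fun x => by
    obtain ⟨r, rfl⟩ := IsSimpleModule.toSpanSingleton_surjective R hs x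
    rw [LinearMap.toSpanSingleton_apply, map_smul, map_smul]
    exact congrArg (r • ·) (congrArg Subtype.val hfg)
  have isSimple : IsSimpleModule R (R ⧸ 𝔪.asIdeal) :=
    isSimpleModule_iff_quot_maximal.2 ⟨𝔪.asIdeal, 𝔪.isMaximal, ⟨LinearEquiv.refl R _⟩⟩
  calc Module.length R (S →ₗ[R] minInjCogenerator R)
      ≤ Module.length R (LinearMap.range j) := Module.length_le_of_injective _ injective_evalAt
    _ ≤ Module.length R (R ⧸ 𝔪.asIdeal) :=
      Module.length_le_of_surjective _ j.surjective_rangeRestrict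
    _ = 1 := Module.length_eq_one R _

theorem length_hom_le_add (E : Type w) [AddCommGroup E] [Module R E] {M : Type v} [AddCommGroup M]
    [Module R M] (N : Submodule R M) : Module.length R (M →ₗ[R] E) ≤
      Module.length R (N →ₗ[R] E) + Module.length R ((M ⧸ N) →ₗ[R] E) := by
  let ρ : (M →ₗ[R] E) →ₗ[R] N →ₗ[R] E := LinearMap.lcomp R E N.subtype
  let q : ((M ⧸ N) →ₗ[R] E) →ₗ[R] M →ₗ[R] E := LinearMap.lcomp R E N.mkQ
  have hq : LinearMap.ker ρ ≤ LinearMap.range q := fun f hf =>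
    ⟨N.liftQ f fun x hx => LinearMap.congr_fun hf ⟨x, hx⟩, LinearMap.ext fun x => rfl⟩
  rw [Module.length_eq_add_of_exact (LinearMap.ker ρ).subtype ρ.rangeRestrict
    (LinearMap.ker ρ).subtype_injective ρ.surjective_rangeRestrict (by
      rw [LinearMap.exact_iff, LinearMap.ker_rangeRestrict, Submodule.range_subtype]), add_comm]
  exact add_le_add (Module.length_le_of_injective _ (LinearMap.range ρ).subtype_injective)
    ((Module.length_le_of_injective _ (Submodule.inclusion_injective hq)).trans
      (Module.length_le_of_surjective _ q.surjective_rangeRestrict))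

theorem length_hom_minInjCogenerator_le {M : Type v} [AddCommGroup M] [Module R M]
    (hM : IsFiniteLength R M) :
    Module.length R (M →ₗ[R] minInjCogenerator R) ≤ Module.length R M := by
  induction hM with
  | of_subsingleton => simp
  | @of_simple_quotient M _ _ N _ _ ih =>
    have hMN : Module.length R M = Module.length R N + 1 := by
      rw [Module.length_eq_add_of_exact N.subtype N.mkQ N.subtype_injective N.mkQ_surjective
        (LinearMap.exact_subtype_mkQ N), Module.length_eq_one R (M ⧸ N)]
    rw [hMN]
    exact (length_hom_le_add _ N).trans
      (add_le_add ih (length_hom_minInjCogenerator_le_one (M ⧸ N)))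

theorem isFiniteLength_hom_minInjCogenerator {M : Type v} [AddCommGroup M] [Module R M]
    (hM : IsFiniteLength R M) : IsFiniteLength R (M →ₗ[R] minInjCogenerator R) :=
  Module.length_ne_top_iff.1 (ne_top_of_le_ne_top (Module.length_ne_top_iff.2 hM)
    (length_hom_minInjCogenerator_le hM))

theorem injective_applyₗ_minInjCogenerator (M : Type u) [AddCommGroup M] [Module R M] :
    Function.Injective (LinearMap.applyₗ (R := R) (M := M) (M₂ := minInjCogenerator R)) :=
  (injective_iff_map_eq_zero _).2 fun x hx => by
    by_contra hx0
    obtain ⟨f, hf⟩ :=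
      (isMinimalInjectiveCogenerator_minInjCogenerator R).isCogenerator M x hx0
    exact hf (LinearMap.congr_fun hx f)

theorem bijective_applyₗ_minInjCogenerator {M : Type u} [AddCommGroup M] [Module R M]
    (hM : IsFiniteLength R M) :
    Function.Bijective (LinearMap.applyₗ (R := R) (M := M) (M₂ := minInjCogenerator R)) := by
  let E := minInjCogenerator R
  let ev : M →ₗ[R] (M →ₗ[R] E) →ₗ[R] E := LinearMap.applyₗ
  have hev : Function.Injective ev := injective_applyₗ_minInjCogenerator M
  have hle : Module.length R ((M →ₗ[R] E) →ₗ[R] E) ≤ Module.length R M :=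
    (length_hom_minInjCogenerator_le (isFiniteLength_hom_minInjCogenerator hM)).trans
      (length_hom_minInjCogenerator_le hM)
  rw [Module.length_eq_add_of_exact ev (LinearMap.range ev).mkQ hev (Submodule.mkQ_surjective _)
    (LinearMap.exact_map_mkQ_range ev)] at hle
  have hcoker : Module.length R (((M →ₗ[R] E) →ₗ[R] E) ⧸ LinearMap.range ev) = 0 :=
    nonpos_iff_eq_zero.1 ((ENat.add_le_add_iff_left (Module.length_ne_top_iff.2 hM)).1
      (hle.trans_eq (add_zero _).symm))
  rw [Module.length_eq_zero_iff, Submodule.Quotient.subsingleton_iff] at hcoker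
  exact ⟨hev, LinearMap.range_eq_top.1 hcoker⟩

end Matlis

section Morita

/-- The conditions on an `A`-`B`-bimodule `D` under which `Hom(-, D)` behaves as a duality from
finitely generated `A`-modules to `B`-modules. The right action of the usual bimodule notation is a
left action of `B` here; that the two actions commute is left to `SMulCommClass`. -/
structure IsDualizingBimodule (A B D : Type u) [Ring A] [Ring B] [AddCommGroup D] [Module A D]
    [Module B D] : Prop where
  isInjective : Module.Injective A D
  isInjective' : Module.Injective B D
  isCogenerator (X : Type u) [AddCommGroup X] [Module A X] (x : X) :
    x ≠ 0 → ∃ f : X →ₗ[A] D, f x ≠ 0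
  exists_eq_smul (φ : D →ₗ[B] D) : ∃ a : A, ∀ x, φ x = a • x

variable {A B D : Type u} [Ring A] [Ring B] [AddCommGroup D] [Module A D] [Module B D]

theorem IsDualizingBimodule.eq_of_forall_apply_eq (hD : IsDualizingBimodule A B D)
    {X : Type u} [AddCommGroup X] [Module A X] {x y : X} (h : ∀ f : X →ₗ[A] D, f x = f y) :
    x = y := by
  by_contra hxy
  obtain ⟨f, hf⟩ := hD.isCogenerator X (x - y) (sub_ne_zero.2 hxy)
  exact hf (by rw [map_sub, h, sub_self])

theorem exists_isFirstSyzygy_finite [IsNoetherianRing A] (X : ModuleCat.{u} A)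
    [Module.Finite A X] : ∃ (P : ModuleCat.{u} A) (K : ModuleCat.{u} A) (f : K ⟶ P) (g : P ⟶ X),
      Module.Finite A K ∧ Projective P ∧ IsShortExact f g := by
  obtain ⟨n, p, hp⟩ := Module.Finite.exists_fin' A X
  exact ⟨_, _, _, _, inferInstanceAs (Module.Finite A (LinearMap.ker p)),
    (IsProjective.iff_projective (Fin n → A)).1 inferInstance,
    isShortExact_of_shortExact (LinearMap.shortExact_shortComplexKer hp)⟩

theorem IsShortExact.lcomp [SMulCommClass A B D] (hD : Module.Injective A D)
    {X Y Z : ModuleCat.{u} A} {f : X ⟶ Y} {g : Y ⟶ Z} (h : IsShortExact f g) :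
    IsShortExact (ModuleCat.ofHom (LinearMap.lcomp B D g.hom))
      (ModuleCat.ofHom (LinearMap.lcomp B D f.hom)) := by
  have lcomp_f_surjective : Function.Surjective (LinearMap.lcomp B D f.hom) :=
    Module.Injective.extension_property A D X Y f.hom ((ModuleCat.mono_iff_injective f).1 h.mono)
  have lcomp_g_injective : Function.Injective (LinearMap.lcomp B D g.hom) :=
    LinearMap.lcomp_injective_of_surjective _ ((ModuleCat.epi_iff_surjective g).1 h.epi)
  have exact_lcomp : Function.Exact (LinearMap.lcomp B D g.hom) (LinearMap.lcomp B D f.hom) := by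
    refine fun ψ => ⟨fun hψ => ?_, ?_⟩
    · obtain ⟨φ, hφ⟩ := h.exists_desc (ModuleCat.ofHom ψ) (ModuleCat.hom_ext hψ)
      exact ⟨φ.hom, congrArg ModuleCat.Hom.hom hφ⟩
    · rintro ⟨φ, rfl⟩
      change φ ∘ₗ (f ≫ g).hom = 0
      rw [h.zero, ModuleCat.hom_zero, LinearMap.comp_zero]
  exact ⟨ModuleCat.hom_ext exact_lcomp.linearMap_comp_eq_zero,
    ModuleCat.shortComplex_shortExact _ exact_lcomp lcomp_g_injective lcomp_f_surjective⟩

variable [SMulCommClass A B D] [SMulCommClass B A D]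

theorem injective_hom_of_projective (hD : Module.Injective B D) {P : Type u} [AddCommGroup P]
    [Module A P] [Module.Projective A P] : Module.Injective B (P →ₗ[A] D) := by
  refine ⟨fun X Y _ _ _ _ f hf k => ?_⟩
  have surjective_restrict : Function.Surjective (LinearMap.lcomp A D f) :=
    Module.Injective.extension_property B D X Y f hf
  obtain ⟨l, hl⟩ := Module.projective_lifting_property _ k.flip surjective_restrict
  exact ⟨l.flip, fun x => LinearMap.ext fun p => LinearMap.congr_fun (LinearMap.congr_fun hl p) x⟩

theorem exists_forall_apply_eq_of_finite_free
    (h : ∀ φ : D →ₗ[B] D, ∃ a : A, ∀ x, φ x = a • x) {n : ℕ}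
    (Θ : ((Fin n → A) →ₗ[A] D) →ₗ[B] D) : ∃ a : Fin n → A, ∀ φ, Θ φ = φ a := by
  let coord (j : Fin n) : D →ₗ[B] (Fin n → A) →ₗ[A] D :=
    (LinearMap.toSpanSingleton A (D →ₗ[B] D) LinearMap.id ∘ₗ LinearMap.proj j).flip
  choose a ha using fun j => h (Θ ∘ₗ coord j)
  refine ⟨a, fun φ => ?_⟩
  have hφ : φ = ∑ j, coord j (φ (Pi.single j 1)) := LinearMap.pi_ext' fun i => by
    ext
    simp [coord, Pi.single_apply, DFunLike.ite_apply]
  calc Θ φ = ∑ j, a j • φ (Pi.single j 1) := by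
        conv_lhs => rw [hφ, map_sum]
        exact Finset.sum_congr rfl fun j _ => ha j _
    _ = φ a := by
        conv_rhs => rw [pi_eq_sum_univ' a]
        simp only [map_sum, map_smul]

theorem IsDualizingBimodule.projective_of_injective_hom (hD : IsDualizingBimodule A B D)
    {K : Type u} [AddCommGroup K] [Module A K] [Module.Finite A K]
    (hK : Module.Injective B (K →ₗ[A] D)) : Module.Projective A K := by
  obtain ⟨n, p, hp⟩ := Module.Finite.exists_fin' A K
  obtain ⟨ρ, hρ⟩ := hK.out (LinearMap.lcomp B D p)
    (fun φ ψ hφ => (LinearMap.cancel_right hp).1 hφ) LinearMap.id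
  choose s hs using fun k : K => exists_forall_apply_eq_of_finite_free hD.exists_eq_smul
    ((LinearMap.id : (K →ₗ[A] D) →ₗ[B] K →ₗ[A] D).flip k ∘ₗ ρ)
  replace hs (k : K) (φ : (Fin n → A) →ₗ[A] D) : φ (s k) = ρ φ k := (hs k φ).symm
  let splitting : K →ₗ[A] Fin n → A :=
    { toFun := s
      map_add' := fun k l => hD.eq_of_forall_apply_eq fun φ => by
        rw [map_add, hs, hs, hs, map_add]
      map_smul' := fun a k => hD.eq_of_forall_apply_eq fun φ => by
        rw [RingHom.id_apply, map_smul, hs, hs, map_smul] }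
  refine Module.Projective.of_split splitting p (LinearMap.ext fun k => ?_)
  exact hD.eq_of_forall_apply_eq fun φ =>
    (hs k (φ ∘ₗ p)).trans (LinearMap.congr_fun (hρ φ) k)

theorem IsDualizingBimodule.hasInjectiveDimensionLE_hom_iff [IsNoetherianRing A]
    (hD : IsDualizingBimodule A B D) {n : ℕ} (X : ModuleCat.{u} A) [Module.Finite A X] :
    HasInjectiveDimensionLE (ModuleCat.of B (X →ₗ[A] D)) n ↔ HasProjectiveDimensionLE X n := by
  induction n generalizing X with
  | zero =>
    rw [← hasProjectiveDimensionLE_op_iff, ← projective_iff_hasProjectiveDimensionLE_zero,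
      ← projective_iff_hasProjectiveDimensionLE_zero, ← Injective.injective_iff_projective_op,
      ← IsProjective.iff_projective]
    refine ⟨fun h => hD.projective_of_injective_hom
      (Module.injective_module_of_injective_object B _ (inj := h)), fun _ => ?_⟩
    exact Module.injective_object_of_injective_module B _
      (inj := injective_hom_of_projective hD.isInjective')
  | succ n ih =>
    obtain ⟨P, K, f, g, _, hP, hfg⟩ := exists_isFirstSyzygy_finite X
    have := (IsProjective.iff_projective P).2 hP
    have : Injective (ModuleCat.of B (P →ₗ[A] D)) :=
      Module.injective_object_of_injective_module B _
        (inj := injective_hom_of_projective hD.isInjective')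
    have hDK : IsFirstSyzygy (op (ModuleCat.of B (X →ₗ[A] D))) (op (ModuleCat.of B (K →ₗ[A] D))) :=
      ⟨op (ModuleCat.of B (P →ₗ[A] D)), _, _, inferInstance, (hfg.lcomp hD.isInjective).op⟩
    have hXK : IsFirstSyzygy X K := ⟨P, f, g, hP, hfg⟩
    rw [hXK.hasProjectiveDimensionLE_succ_iff, ← ih, ← hasProjectiveDimensionLE_op_iff,
      ← hasProjectiveDimensionLE_op_iff, ← hDK.hasProjectiveDimensionLE_succ_iff]

end Morita

section DualModule

variable {R A : Type u} [CommRing R] [Ring A] [Algebra R A]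

variable (R A) in
/-- The elements of `DA` as `R`-linear maps from `A` to the injective cogenerator. -/
def dualModuleEquiv : dualModule R A ≃+ (A →ₗ[R] minInjCogenerator R) :=
  let restrictScalarsEquiv : (ModuleCat.restrictScalars (algebraMap R A)).obj (.of A A) ≃ₗ[R] A :=
    { AddEquiv.refl A with map_smul' := fun r (a : A) => (Algebra.smul_def r a).symm }
  (ModuleCat.CoextendScalars.equiv (algebraMap R A) (minInjCogenerator R)).toAddEquiv.trans
    (restrictScalarsEquiv.congrLeft (minInjCogenerator R) R).toAddEquiv

theorem dualModuleEquiv_smul_apply (a : A) (f : dualModule R A) (x : A) :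
    dualModuleEquiv R A (a • f) x = dualModuleEquiv R A f (x * a) :=
  rfl

variable (R A) in
/-- The left module dual to the right module `A` has the same elements as the right module dual to
the left module `A`. -/
def dualModuleOpEquiv : dualModule R A ≃+ dualModule R Aᵐᵒᵖ :=
  ((dualModuleEquiv R A).trans
    ((MulOpposite.opLinearEquiv R).congrLeft (minInjCogenerator R) R).toAddEquiv).trans
      (dualModuleEquiv R Aᵐᵒᵖ).symm

/-- The right module structure of the bimodule `DA`. -/
instance : Module Aᵐᵒᵖ (dualModule R A) := (dualModuleOpEquiv R A).module Aᵐᵒᵖ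

theorem dualModuleEquiv_op_smul_apply (b : Aᵐᵒᵖ) (f : dualModule R A) (x : A) :
    dualModuleEquiv R A (b • f) x = dualModuleEquiv R A f (b.unop * x) :=
  rfl

theorem dualModule_ext {f g : dualModule R A}
    (h : ∀ x, dualModuleEquiv R A f x = dualModuleEquiv R A g x) : f = g :=
  (dualModuleEquiv R A).injective (LinearMap.ext h)

instance : SMulCommClass A Aᵐᵒᵖ (dualModule R A) where
  smul_comm a b f := dualModule_ext fun x => by
    rw [dualModuleEquiv_smul_apply, dualModuleEquiv_op_smul_apply, dualModuleEquiv_op_smul_apply,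
      dualModuleEquiv_smul_apply, mul_assoc]

instance : SMulCommClass Aᵐᵒᵖ A (dualModule R A) := SMulCommClass.symm _ _ _

theorem dualModuleEquiv_algebraMap_smul (r : R) (f : dualModule R A) :
    dualModuleEquiv R A (algebraMap R A r • f) = r • dualModuleEquiv R A f :=
  LinearMap.ext fun x => by
    rw [dualModuleEquiv_smul_apply, ← Algebra.commutes, ← Algebra.smul_def, map_smul,
      LinearMap.smul_apply]

variable (R A) in
theorem injective_dualModule : Injective (dualModule R A) := by
  have := (isMinimalInjectiveCogenerator_minInjCogenerator R).isInjective
  have := Module.injective_object_of_injective_module R (minInjCogenerator R)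
  exact Injective.injective_of_adjoint
    (ModuleCat.restrictCoextendScalarsAdj (algebraMap R A)) (minInjCogenerator R)

theorem exists_dualModule_apply_ne_zero (X : Type u) [AddCommGroup X] [Module A X] (x : X)
    (hx : x ≠ 0) : ∃ f : X →ₗ[A] dualModule R A, f x ≠ 0 := by
  let _ : Module R X := Module.compHom X (algebraMap R A)
  obtain ⟨φ, hφ⟩ := (isMinimalInjectiveCogenerator_minInjCogenerator R).isCogenerator X x hx
  let f : X →ₗ[A] dualModule R A :=
    (ModuleCat.RestrictionCoextensionAdj.HomEquiv.fromRestriction (algebraMap R A)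
      (Y := .of A X) (ModuleCat.ofHom φ)).hom
  refine ⟨f, fun hf => hφ ?_⟩
  have apply_one : dualModuleEquiv R A (f x) 1 = φ ((1 : A) • x : X) := rfl
  rw [← one_smul A x, ← apply_one, hf, map_zero, LinearMap.zero_apply]

section Artinian

variable [IsArtinianRing R] [Module.Finite R A]

theorem isFiniteLength_of_finite (M : Type u) [AddCommGroup M] [Module R M] [Module.Finite R M] :
    IsFiniteLength R M :=
  isFiniteLength_iff_isNoetherian_isArtinian.2 ⟨inferInstance, inferInstance⟩

instance : Module.Finite R (A →ₗ[R] minInjCogenerator R) := by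
  have := (isFiniteLength_iff_isNoetherian_isArtinian.1
    (isFiniteLength_hom_minInjCogenerator (isFiniteLength_of_finite (R := R) A))).1
  infer_instance

/-- Evaluating `φ f` at `1` is an element of the double dual of `A`, hence given by Matlis duality
by some `a`. -/
theorem exists_forall_dualModuleEquiv_apply_eq (φ : dualModule R A →ₗ[A] dualModule R A) :
    ∃ a : A, ∀ f x, dualModuleEquiv R A (φ f) x = dualModuleEquiv R A f (a * x) := by
  let evalOne : (A →ₗ[R] minInjCogenerator R) →ₗ[R] minInjCogenerator R :=
    { toFun := fun f => dualModuleEquiv R A (φ ((dualModuleEquiv R A).symm f)) 1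
      map_add' := fun f g => by simp only [map_add, LinearMap.add_apply]
      map_smul' := fun r f => by
        have h : (dualModuleEquiv R A).symm (r • f) =
            algebraMap R A r • (dualModuleEquiv R A).symm f := by
          rw [AddEquiv.symm_apply_eq, dualModuleEquiv_algebraMap_smul, AddEquiv.apply_symm_apply]
        rw [h, map_smul, dualModuleEquiv_algebraMap_smul, LinearMap.smul_apply, RingHom.id_apply] }
  obtain ⟨a, ha⟩ :=
    (bijective_applyₗ_minInjCogenerator (isFiniteLength_of_finite (R := R) A)).2 evalOne
  refine ⟨a, fun f x => ?_⟩
  have h := LinearMap.congr_fun ha (dualModuleEquiv R A (x • f))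
  change dualModuleEquiv R A (x • f) a =
    dualModuleEquiv R A (φ ((dualModuleEquiv R A).symm (dualModuleEquiv R A (x • f)))) 1 at h
  rw [AddEquiv.symm_apply_apply, LinearMap.map_smul φ, dualModuleEquiv_smul_apply,
    dualModuleEquiv_smul_apply, one_mul] at h
  exact h.symm

variable (R A) in
theorem isDualizingBimodule_dualModule : IsDualizingBimodule A Aᵐᵒᵖ (dualModule R A) where
  isInjective :=
    Module.injective_module_of_injective_object A _ (inj := injective_dualModule R A)
  isInjective' := by
    have : Module.Injective Aᵐᵒᵖ (dualModule R Aᵐᵒᵖ) :=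
      Module.injective_module_of_injective_object Aᵐᵒᵖ _ (inj := injective_dualModule R Aᵐᵒᵖ)
    let e := (dualModuleOpEquiv R A).linearEquiv Aᵐᵒᵖ
    exact (Module.Baer.of_equiv e.symm (.of_injective this)).injective
  isCogenerator := exists_dualModule_apply_ne_zero
  exists_eq_smul φ := by
    let e := (dualModuleOpEquiv R A).linearEquiv Aᵐᵒᵖ
    obtain ⟨a, ha⟩ := exists_forall_dualModuleEquiv_apply_eq
      (e.toLinearMap ∘ₗ φ ∘ₗ e.symm.toLinearMap)
    refine ⟨a.unop, fun f => dualModule_ext fun x => ?_⟩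
    have h := ha (e f) (.op x)
    rw [LinearMap.comp_apply, LinearMap.comp_apply, LinearEquiv.coe_coe, LinearEquiv.coe_coe,
      LinearEquiv.symm_apply_apply] at h
    exact h

variable (R A) in
theorem finite_dualModule : Module.Finite A (dualModule R A) := by
  let _ : Module R (dualModule R A) := Module.compHom _ (algebraMap R A)
  have : IsScalarTower R A (dualModule R A) := .of_algebraMap_smul fun _ _ => rfl
  let e : dualModule R A ≃ₗ[R] (A →ₗ[R] minInjCogenerator R) :=
    { dualModuleEquiv R A with map_smul' := dualModuleEquiv_algebraMap_smul }
  have : Module.Finite R (dualModule R A) := Module.Finite.equiv e.symm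
  exact Module.Finite.of_restrictScalars_finite R A _

theorem bijective_toModuleEnd_dualModule :
    Function.Bijective fun a : A =>
      Module.toModuleEnd A (S := Aᵐᵒᵖ) (dualModule R A) (MulOpposite.op a) := by
  refine ⟨fun a b hab => ?_, fun φ => ?_⟩
  · refine injective_applyₗ_minInjCogenerator (R := R) A (LinearMap.ext fun f => ?_)
    have h := congrArg (dualModuleEquiv R A · 1)
      (LinearMap.congr_fun hab ((dualModuleEquiv R A).symm f))
    change dualModuleEquiv R A ((dualModuleEquiv R A).symm f) (a * 1) =
      dualModuleEquiv R A ((dualModuleEquiv R A).symm f) (b * 1) at h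
    rwa [AddEquiv.apply_symm_apply, mul_one, mul_one] at h
  · obtain ⟨a, ha⟩ := exists_forall_dualModuleEquiv_apply_eq φ
    exact ⟨a, LinearMap.ext fun f => dualModule_ext fun x => (ha f x).symm⟩

variable (R A) in
theorem hasInjectiveDimensionLE_op_regular_iff {n : ℕ} :
    HasInjectiveDimensionLE (ModuleCat.of Aᵐᵒᵖ A) n ↔
      HasProjectiveDimensionLE (dualModule R A) n := by
  let regularEquiv : A ≃ₗ[Aᵐᵒᵖ] (dualModule R A →ₗ[A] dualModule R A) := .ofBijective
    { toFun := fun a => Module.toModuleEnd A (S := Aᵐᵒᵖ) (dualModule R A) (.op a)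
      map_add' := fun a b => by rw [MulOpposite.op_add, map_add]
      map_smul' := fun b a => LinearMap.ext fun f => by
        change MulOpposite.op (a * b.unop) • f = b • MulOpposite.op a • f
        rw [smul_smul, MulOpposite.op_mul, MulOpposite.op_unop] }
    bijective_toModuleEnd_dualModule
  have := finite_dualModule R A
  have : IsNoetherianRing A := isNoetherian_of_tower R inferInstance
  rw [← (isDualizingBimodule_dualModule R A).hasInjectiveDimensionLE_hom_iff (dualModule R A)]
  exact ⟨fun _ => hasInjectiveDimensionLT_of_iso regularEquiv.toModuleIso _,
    fun _ => hasInjectiveDimensionLT_of_iso regularEquiv.toModuleIso.symm _⟩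

end Artinian

end DualModule

section DirectSums

variable {A : Type u} [Ring A]

theorem exists_finset_forall_support_subset {ι N M : Type*} [AddCommGroup N] [Module A N]
    [Module.Finite A N] [AddCommGroup M] [Module A M] (g : N →ₗ[A] ι →₀ M) :
    ∃ s : Finset ι, ∀ x, (g x).support ⊆ s := by
  classical
  obtain ⟨t, ht⟩ := Module.Finite.fg_top (R := A) (M := N)
  refine ⟨t.biUnion fun x => (g x).support, fun x i hi => by_contra fun his => ?_⟩
  have hle : Submodule.span A t ≤ LinearMap.ker (Finsupp.lapply i ∘ₗ g) :=
    Submodule.span_le.2 fun y hy => Finsupp.notMem_support_iff.1 fun h =>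
      his (Finset.mem_biUnion.2 ⟨y, hy, h⟩)
  exact Finsupp.mem_support_iff.1 hi (hle (ht ▸ Submodule.mem_top : x ∈ Submodule.span A t))

/-- Bass–Papp: a map from a finitely generated ideal into a direct sum has only finitely many
nonzero components, which can be extended one at a time. -/
theorem injective_finsupp [IsNoetherianRing A] (ι J : Type u) [AddCommGroup J] [Module A J]
    [hJ : Module.Injective A J] : Module.Injective A (ι →₀ J) := by
  classical
  refine Module.Baer.injective fun I g => ?_
  obtain ⟨s, hs⟩ := exists_finset_forall_support_subset g
  choose h hh using fun i => Module.Baer.of_injective hJ I (Finsupp.lapply i ∘ₗ g)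
  refine ⟨∑ i ∈ s, Finsupp.lsingle i ∘ₗ h i, fun x hx => ?_⟩
  calc (∑ i ∈ s, Finsupp.lsingle i ∘ₗ h i) x
      = ∑ i ∈ s, Finsupp.single i (g ⟨x, hx⟩ i) := by
        rw [LinearMap.sum_apply]
        exact Finset.sum_congr rfl fun i _ => congrArg (Finsupp.single i) (hh i x hx)
    _ = (g ⟨x, hx⟩).sum Finsupp.single :=
        (Finsupp.sum_of_support_subset _ (hs _) _ fun _ _ => Finsupp.single_zero _).symm
    _ = g ⟨x, hx⟩ := Finsupp.sum_single _

section Cogenerator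

variable {J : Type u} [AddCommGroup J] [Module A J]

theorem exists_injective_finsupp_of_isSemisimpleModule
    (hJ : ∀ (X : Type u) [AddCommGroup X] [Module A X] (x : X), x ≠ 0 → ∃ f : X →ₗ[A] J, f x ≠ 0)
    (S : Type u) [AddCommGroup S] [Module A S] [IsSemisimpleModule A S] :
    ∃ (ι : Type u) (f : S →ₗ[A] ι →₀ J), Function.Injective f := by
  classical
  obtain ⟨s, e, -, hs⟩ := IsSemisimpleModule.exists_linearEquiv_dfinsupp A S
  have exists_injective (m : s) : ∃ f : m.1 →ₗ[A] J, Function.Injective f := by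
    have := hs m
    have := IsSimpleModule.nontrivial A m.1
    obtain ⟨x, hx⟩ := exists_ne (0 : m.1)
    obtain ⟨f, hf⟩ := hJ m.1 x hx
    exact ⟨f, f.injective_or_eq_zero.resolve_right fun h => hf (LinearMap.congr_fun h x)⟩
  choose f hf using exists_injective
  let toFinsupp := (finsuppLequivDFinsupp (ι := s) A (M := J)).symm
  exact ⟨s, toFinsupp.toLinearMap ∘ₗ DFinsupp.mapRange.linearMap f ∘ₗ e.toLinearMap,
    toFinsupp.injective.comp
      (((DFinsupp.mapRange_injective (hf := fun _ => map_zero _)).2 hf).comp e.injective)⟩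

theorem isAtomic_submodule [IsArtinianRing A] (M : Type*) [AddCommGroup M] [Module A M] :
    IsAtomic (Submodule A M) := by
  refine ⟨fun N => or_iff_not_imp_left.2 fun hN => ?_⟩
  obtain ⟨x, hx, hx0⟩ := Submodule.exists_mem_ne_zero_of_ne_bot hN
  let Ax := Submodule.span A {x}
  have : Nontrivial Ax :=
    ⟨⟨x, Submodule.mem_span_singleton_self x⟩, 0, fun h => hx0 (congrArg Subtype.val h)⟩
  obtain ⟨S, hS⟩ := IsAtomic.exists_atom (Submodule A Ax)
  exact ⟨_, (((Submodule.mapIic Ax).isAtom_iff S).2 hS).of_isAtom_coe_Iic,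
    (Submodule.mapIic Ax S).2.trans ((Submodule.span_singleton_le_iff_mem _ _).2 hx)⟩

/-- The socle is essential, so it suffices to embed the socle. -/
theorem exists_injective_finsupp [IsArtinianRing A] [Module.Injective A J]
    (hJ : ∀ (X : Type u) [AddCommGroup X] [Module A X] (x : X), x ≠ 0 → ∃ f : X →ₗ[A] J, f x ≠ 0)
    (M : Type u) [AddCommGroup M] [Module A M] :
    ∃ (ι : Type u) (f : M →ₗ[A] ι →₀ J), Function.Injective f := by
  let socle : Submodule A M := ⨆ S ∈ {S : Submodule A M | IsSimpleModule A S}, S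
  have : IsSemisimpleModule A socle := isSemisimpleModule_biSup_of_isSemisimpleModule_submodule
    fun S (_ : IsSimpleModule A S) => inferInstance
  obtain ⟨ι, f, hf⟩ := exists_injective_finsupp_of_isSemisimpleModule hJ socle
  obtain ⟨g, hg⟩ := (injective_finsupp (A := A) ι J).out socle.subtype socle.subtype_injective f
  refine ⟨ι, g, LinearMap.ker_eq_bot.1 (by_contra fun hne => ?_)⟩
  obtain ⟨S, hS, hSker⟩ := ((isAtomic_submodule M).eq_bot_or_exists_atom_le _).resolve_left hne
  have hSsocle : S ≤ socle :=
    le_biSup (fun S : Submodule A M => S) (isSimpleModule_iff_isAtom.2 hS)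
  refine hS.1 ((Submodule.eq_bot_iff S).2 fun x hx => ?_)
  have : f ⟨x, hSsocle hx⟩ = f 0 := by rw [← hg, map_zero]; exact hSker hx
  exact congrArg Subtype.val (hf this)

end Cogenerator

section FiniteLength

variable {R : Type u} [CommRing R] {M : Type u} [AddCommGroup M] [Module R M] {ι : Type u}

theorem eq_of_forall_minInjCogenerator_apply_eq {x y : M}
    (h : ∀ v : M →ₗ[R] minInjCogenerator R, v x = v y) : x = y :=
  injective_applyₗ_minInjCogenerator M (LinearMap.ext h)

theorem exists_finsupp_forall_apply_eq (hM : IsFiniteLength R M)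
    (p : (ι → minInjCogenerator R) →ₗ[R] ι →₀ minInjCogenerator R) (x : ι → M) :
    ∃ y : ι →₀ M, ∀ (v : M →ₗ[R] minInjCogenerator R) i, v (y i) = p (v ∘ x) i := by
  let g : (M →ₗ[R] minInjCogenerator R) →ₗ[R] ι →₀ minInjCogenerator R :=
    p ∘ₗ LinearMap.pi fun j => LinearMap.applyₗ (x j)
  have := (isFiniteLength_iff_isNoetherian_isArtinian.1 (isFiniteLength_hom_minInjCogenerator hM)).1
  obtain ⟨s, hs⟩ := exists_finset_forall_support_subset g
  choose a ha using fun i =>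
    (bijective_applyₗ_minInjCogenerator hM).2 (Finsupp.lapply i ∘ₗ g)
  have apply_a (v : M →ₗ[R] minInjCogenerator R) i : v (a i) = p (v ∘ x) i :=
    LinearMap.congr_fun (ha i) v
  refine ⟨Finsupp.onFinset s a fun i hi => by_contra fun his => hi ?_, apply_a⟩
  refine eq_of_forall_minInjCogenerator_apply_eq (R := R) fun v => ?_
  rw [map_zero, apply_a]
  exact Finsupp.notMem_support_iff.1 fun h => his (hs v h)

/-- Transport a retraction of `E^ι` onto `E^(ι)`, which exists as `E^(ι)` is injective over `R`,
through Matlis duality. -/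
theorem exists_leftInverse_lcoeFun [IsNoetherianRing R] (hM : IsFiniteLength R M) [Module A M]
    [SMulCommClass A R M] (ι : Type u) :
    ∃ ρ : (ι → M) →ₗ[A] ι →₀ M, ∀ x : ι →₀ M, ρ x = x := by
  have := (isMinimalInjectiveCogenerator_minInjCogenerator R).isInjective
  obtain ⟨p, hp⟩ := (injective_finsupp (A := R) ι (minInjCogenerator R)).out
    (Finsupp.lcoeFun : (ι →₀ minInjCogenerator R) →ₗ[R] ι → minInjCogenerator R)
    DFunLike.coe_injective LinearMap.id
  choose ρ hρ using exists_finsupp_forall_apply_eq hM p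
  refine ⟨{ toFun := ρ, map_add' := fun x y => ?_, map_smul' := fun b x => ?_ }, fun x => ?_⟩ <;>
    refine Finsupp.ext fun i => eq_of_forall_minInjCogenerator_apply_eq (R := R) fun v => ?_
  · calc v (ρ (x + y) i) = p (v ∘ x + v ∘ y) i := by
          rw [hρ]; exact congrArg (p · i) (funext fun j => map_add v _ _)
      _ = v ((ρ x + ρ y) i) := by
          rw [map_add, Finsupp.add_apply, Finsupp.add_apply, map_add, hρ, hρ]
  · calc v (ρ (b • x) i) = p ((v ∘ₗ Module.toModuleEnd R M b) ∘ x) i := hρ _ v i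
      _ = v ((b • ρ x) i) := (hρ x (v ∘ₗ Module.toModuleEnd R M b) i).symm
  · calc v (ρ x i) = p (x.mapRange v (map_zero v)) i := hρ x v i
      _ = v (x i) := DFunLike.congr_fun (hp (x.mapRange v (map_zero v))) i

end FiniteLength

section Retracts

variable (ι : Type u) (X : ModuleCat.{u} A)

/-- The coproduct of copies of a module consists of the finitely supported families. -/
def sigmaIsoFinsupp : ∐ (fun _ : ι => X) ≅ ModuleCat.of A (ι →₀ X) := by
  classical
  exact ModuleCat.coprodIsoDirectSum (fun _ : ι => X) ≪≫
    (finsuppLEquivDirectSum A X ι).symm.toModuleIso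

theorem exists_retract_sigma_regular (P : ModuleCat.{u} A) [Projective P] :
    ∃ ι : Type u, Nonempty (Retract P (∐ fun _ : ι => ModuleCat.of A A)) := by
  obtain ⟨s, hs⟩ := Module.projective_def'.1 ((IsProjective.iff_projective P).2 ‹_›)
  let r : Retract P (ModuleCat.of A (P →₀ A)) :=
    ⟨ModuleCat.ofHom s, ModuleCat.ofHom (Finsupp.linearCombination A id), ModuleCat.hom_ext hs⟩
  exact ⟨P, ⟨r.trans (.ofIso (sigmaIsoFinsupp P (.of A A)).symm)⟩⟩

theorem exists_retract_sigma_of_injective [IsArtinianRing A] {J : ModuleCat.{u} A} [Injective J]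
    (hJ : ∀ (X : Type u) [AddCommGroup X] [Module A X] (x : X), x ≠ 0 → ∃ f : X →ₗ[A] J, f x ≠ 0)
    (I : ModuleCat.{u} A) [Injective I] :
    ∃ ι : Type u, Nonempty (Retract I (∐ fun _ : ι => J)) := by
  have := Module.injective_module_of_injective_object A I
  have := Module.injective_module_of_injective_object A J
  obtain ⟨ι, f, hf⟩ := exists_injective_finsupp hJ I
  obtain ⟨r, hr⟩ := Module.Injective.out f hf LinearMap.id
  let r : Retract I (ModuleCat.of A (ι →₀ J)) :=
    ⟨ModuleCat.ofHom f, ModuleCat.ofHom r, ModuleCat.hom_ext (LinearMap.ext hr)⟩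
  exact ⟨ι, ⟨r.trans (.ofIso (sigmaIsoFinsupp ι J).symm)⟩⟩

theorem nonempty_retract_sigma_pi {R : Type u} [CommRing R] [IsNoetherianRing R] [Module R X]
    [SMulCommClass A R X] (hX : IsFiniteLength R X) :
    Nonempty (Retract (∐ fun _ : ι => X) (∏ᶜ fun _ : ι => X)) := by
  obtain ⟨ρ, hρ⟩ := exists_leftInverse_lcoeFun (A := A) hX ι
  let r : Retract (ModuleCat.of A (ι →₀ X)) (ModuleCat.of A (ι → X)) :=
    ⟨ModuleCat.ofHom Finsupp.lcoeFun, ModuleCat.ofHom ρ, ModuleCat.hom_ext (LinearMap.ext hρ)⟩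
  exact ⟨.trans (.ofIso (sigmaIsoFinsupp ι X)) <|
    r.trans (.ofIso (ModuleCat.piIsoPi fun _ : ι => X).symm)⟩

end Retracts

end DirectSums

section ModuleCategory

variable {A : Type u} [Ring A]

variable (A) in
theorem gproj_eq_gorensteinProjective : GProj A = gorensteinProjective (ModuleCat.{u} A) :=
  funext fun _ => propext gproj_iff_gorensteinProjective

variable (A) in
theorem ginj_eq_gorensteinProjective_op [HasExt.{w} (ModuleCat.{u} A)ᵒᵖ] :
    GInj A = fun M => gorensteinProjective (ModuleCat.{u} A)ᵒᵖ (op M) :=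
  funext fun _ => propext ⟨gorensteinProjective_op_of_ginj, ginj_of_gorensteinProjective_op⟩

theorem gproj_eq_syzygies_iff {d : ℕ} :
    GProj A = syzygies A d ↔ IsGorensteinCategory (ModuleCat.{u} A) d := by
  rw [← gorensteinProjective_eq_isNthSyzygy_iff, gproj_eq_gorensteinProjective]
  simp only [funext_iff, syzygies, isSyzygy_iff]

theorem ginj_eq_cosyzygies_iff {d : ℕ} :
    GInj A = cosyzygies A d ↔ IsGorensteinCategory (ModuleCat.{u} A) d := by
  let _ := HasExt.standard (ModuleCat.{u} A)ᵒᵖ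
  rw [show IsGorensteinCategory (ModuleCat.{u} A) d ↔ IsGorensteinCategory (ModuleCat.{u} A)ᵒᵖ d
      from ⟨.op, .of_op⟩, ← gorensteinProjective_eq_isNthSyzygy_iff,
    ginj_eq_gorensteinProjective_op]
  simp only [funext_iff, op_surjective.forall, op_surjective.exists, cosyzygies, isCosyzygy_iff]

section Gorenstein

variable {d : ℕ} (h : IsGorensteinCategory (ModuleCat.{u} A) d)

include h

theorem IsGorensteinCategory.isCotorsionPair_gproj :
    IsCotorsionPair (GProj A) (projDimLE A d) := by
  rw [gproj_eq_gorensteinProjective]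
  exact h.isCotorsionPair

theorem IsGorensteinCategory.isCotorsionPair_ginj :
    IsCotorsionPair (injDimLE A d) (GInj A) := by
  let _ := HasExt.standard (ModuleCat.{u} A)ᵒᵖ
  have := h.op.isCotorsionPair.of_op
  simp only [hasProjectiveDimensionLE_op_iff] at this
  rwa [ginj_eq_gorensteinProjective_op]

end Gorenstein

end ModuleCategory

section ArtinAlgebra

variable (R A : Type u) [CommRing R] [IsArtinianRing R] [Ring A] [Algebra R A] [Module.Finite R A]

include R

theorem exists_retract_sigma_dualModule (I : ModuleCat.{u} A) [Injective I] :
    ∃ ι : Type u, Nonempty (Retract I (∐ fun _ : ι => dualModule R A)) := by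
  have : IsArtinianRing A := isArtinian_of_tower R inferInstance
  have := injective_dualModule R A
  exact exists_retract_sigma_of_injective exists_dualModule_apply_ne_zero I

/-- The complement in `A^ι` makes `Ext` into `A^(ι)` accessible, although `Ext` does not commute
with direct sums in the second variable. -/
theorem exists_retract_pi_regular (P : ModuleCat.{u} A) [Projective P] :
    ∃ ι : Type u, Nonempty (Retract P (∏ᶜ fun _ : ι => ModuleCat.of A A)) := by
  obtain ⟨ι, ⟨r⟩⟩ := exists_retract_sigma_regular P
  obtain ⟨r'⟩ := nonempty_retract_sigma_pi (A := A) ι (.of A A)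
    (isFiniteLength_of_finite (R := R) A)
  exact ⟨ι, ⟨r.trans r'⟩⟩

theorem isGorensteinLE_iff_isGorensteinCategory {d : ℕ} :
    IsGorensteinLE A d ↔ IsGorensteinCategory (ModuleCat.{u} A) d := by
  rw [IsGorensteinLE, hasInjectiveDimensionLE_op_regular_iff R A]
  refine ⟨fun ⟨hA, hD⟩ => ⟨fun P _ => ?_, fun I _ => ?_⟩, fun h => ⟨?_, ?_⟩⟩
  · obtain ⟨ι, ⟨r⟩⟩ := exists_retract_pi_regular R A P
    have := hasInjectiveDimensionLE_pi (fun _ : ι => ModuleCat.of A A) fun _ => hA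
    exact r.hasInjectiveDimensionLT _
  · obtain ⟨ι, ⟨r⟩⟩ := exists_retract_sigma_dualModule R A I
    have := hasProjectiveDimensionLE_sigma (fun _ : ι => dualModule R A) fun _ => hD
    exact r.hasProjectiveDimensionLT _
  · exact h.hasInjectiveDimensionLE _ ((IsProjective.iff_projective A).1 inferInstance)
  · exact h.hasProjectiveDimensionLE _ (injective_dualModule R A)

theorem gproj_eq_leftPerp_regular {d : ℕ} (h : IsGorensteinCategory (ModuleCat.{u} A) d) :
    GProj A = leftPerp A (ModuleCat.of A A) := by
  rw [gproj_eq_gorensteinProjective, h.gorensteinProjective_eq_projPerp]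
  refine funext fun M => propext ⟨fun hM i hi => ?_, fun hM P _ i hi => ?_⟩
  · exact hM _ ((IsProjective.iff_projective A).1 inferInstance) i hi
  · obtain ⟨ι, ⟨r⟩⟩ := exists_retract_pi_regular R A P
    exact subsingleton_ext_of_retract_right r (subsingleton_ext_pi _ hi fun _ => hM i hi)

theorem ginj_eq_rightPerp_dualModule {d : ℕ} (h : IsGorensteinCategory (ModuleCat.{u} A) d) :
    GInj A = rightPerp A (dualModule R A) := by
  let _ := HasExt.standard (ModuleCat.{u} A)ᵒᵖ
  rw [ginj_eq_gorensteinProjective_op, h.op.gorensteinProjective_eq_projPerp]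
  refine funext fun M => propext ⟨fun hM i hi => ?_, fun hM => ?_⟩
  · have := injective_dualModule R A
    exact (subsingleton_ext_op_iff i).1 (hM (op (dualModule R A)) inferInstance i hi)
  · rintro ⟨J⟩ hJ i hi
    have := Injective.injective_iff_projective_op.2 hJ
    obtain ⟨ι, ⟨r⟩⟩ := exists_retract_sigma_dualModule R A J
    exact (subsingleton_ext_op_iff i).2
      (subsingleton_ext_of_retract_left r (subsingleton_ext_sigma _ hi fun _ => hM i hi))

end ArtinAlgebra

end GorensteinArtin

end

open GorensteinArtin

theorem mainTheorem2 (R A : Type u) [CommRing R] [IsArtinianRing R] [Ring A] [Algebra R A]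
    [Module.Finite R A] (d : ℕ) :
    List.TFAE [
      GorensteinArtin.IsGorensteinLE A d,
      GorensteinArtin.GProj A = GorensteinArtin.syzygies A d,
      GorensteinArtin.GInj A = GorensteinArtin.cosyzygies A d] ∧
    (GorensteinArtin.IsGorensteinLE A d →
      GorensteinArtin.GProj A = GorensteinArtin.leftPerp A (ModuleCat.of A A) ∧
      GorensteinArtin.GInj A = GorensteinArtin.rightPerp A (GorensteinArtin.dualModule R A) ∧
      GorensteinArtin.IsCotorsionPair (GorensteinArtin.GProj A) (GorensteinArtin.projDimLE A d) ∧
      GorensteinArtin.IsCotorsionPair (GorensteinArtin.injDimLE A d) (GorensteinArtin.GInj A)) := by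
  have hA := isGorensteinLE_iff_isGorensteinCategory R A (d := d)
  refine ⟨?_, fun h => ⟨gproj_eq_leftPerp_regular R A (hA.1 h),
    ginj_eq_rightPerp_dualModule R A (hA.1 h), (hA.1 h).isCotorsionPair_gproj,
    (hA.1 h).isCotorsionPair_ginj⟩⟩
  tfae_have 1 ↔ 2 := hA.trans gproj_eq_syzygies_iff.symm
  tfae_have 1 ↔ 3 := hA.trans ginj_eq_cosyzygies_iff.symm
  tfae_finish
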